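/- Joint degree sequences and the model. A joint degree sequence $S$ on a finite node set $V$ assigns to each node $u$ an in-degree $d_i(u)$ and an out-degree $d_o(u)$ with $\sum_u d_i(u)=\sum_u d_o(u)=:m$. Put $n=|V|$ and, for directions $a,b\in\{i,o\}$, $M_{ab}=\frac1n\sum_{u}d_a(u)d_b(u)$; $\bar a$ is the direction opposite to $a$. A random directed (multi)graph $G$ from the directed configuration model with $S$ is obtained by giving each node $u$ exactly $d_o(u)$ outgoing and $d_i(u)$ incoming stubs and matching the outgoing with the incoming stubs uniformly at random. Closure coefficients. For $x,y\in\{i,o\}$, a wedge of type $xy$ with head $u$, center $v$ and tail $w$ ($u,v,w$ distinct) is an ordered pair of edges, the first joining $u$ and $v$ and having direction $x$ relative to $u$, the second joining $v$ and $w$ and having direction $y$ relative to $v$; an edge has direction $i$ relative to the node it points to and direction $o$ relative to the node it starts from. For $z\in\{i,o\}$ the wedge is $z$-closed if there is an edge joining $u$ and $w$ that has direction $z$ relative to $u$. The global directed closure coefficient $C^{z}_{xy}(G)$ is the number of $z$-closed wedges of type $xy$ divided by the number of wedges of type $xy$ (and $0$ if there is no such wedge). Theorem. Fix $x,y,z\in\{i,o\}$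 and let $(S_k)_{k\ge 1}$ be a sequence of joint degree sequences, with $n$, $m$, $d$, $M$ depending on $k$, such that as $k\to\infty$: (1) (sparsity) $\max_u\max\{d_i(u),d_o(u)\}^2=o(m)$; (2) (no dominating node) $\max_u d_x(u)\,(d_z(u)-\mathbf 1[x=z])=o\big(\sum_u d_x(u)\,(d_z(u)-\mathbf 1[x=z])\big)$ and $\max_u d_{\bar y}(u)\,(d_{\bar z}(u)-\mathbf 1[y=z])=o\big(\sum_u d_{\bar y}(u)\,(d_{\bar z}(u)-\mathbf 1[y=z])\big)$, where $f=o(g)$ means that for each $\varepsilon>0$, $f\le\varepsilon g$ for all large $k$; (3) (wedges are possible) for every $k$ some node $v$ has $d_{\bar x}(v)\,(d_y(v)-\mathbf 1[\bar x=y])>0$. Then the probability that $G$ has a wedge of type $xy$ (so that $C^z_{xy}(G)$ is a genuine fraction) tends to $1$, and $$\mathbb E\big[C^{z}_{xy}(G)\mid S_k\big]=\Big(M_{\bar y\bar z}-\mathbf 1[y=z]\,\frac mn\Big)\Big(M_{xz}-\mathbf 1[x=z]\,\frac mn\Big)\frac{n^2}{m^3}\,(1+o(1)).$$ -/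

import Mathlib

open Filter Topology
open scoped BigOperators

/-- Direction of an edge relative to a chosen end-node: incoming or outgoing. -/
inductive Dir where
  | i : Dir
  | o : Dir
deriving DecidableEq

/-- The opposite direction. -/
def Dir.opp : Dir → Dir
  | .i => .o
  | .o => .i

/-- A directed multigraph with nodes `V` and edges `E`; the edge `e` points from `src e`
to `tgt e`. Self-loops and parallel edges are allowed. -/
structure DirMultigraph (V E : Type*) where
  src : E → V
  tgt : E → V

namespace DirMultigraph

variable {V E : Type*}

/-- The end-node of `e` relative to which `e` has direction `a`
(`e` is incoming to its target and outgoing from its source). -/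
def endAt (G : DirMultigraph V E) : Dir → E → V
  | .i, e => G.tgt e
  | .o, e => G.src e

/-- The ordered pair of edges `(e, f)` is a wedge of type `xy` with head `u`: writing `v` for the
center and `w` for the tail, `e` joins `u` and `v` and has direction `x` relative to the head `u`,
`f` joins `v` and `w` and has direction `y` relative to the center `v`, and `u`, `v`, `w` are
three different nodes (so the two edges have exactly the node `v` in common). -/
def IsWedge (G : DirMultigraph V E) (x y : Dir) (u : V) (e f : E) : Prop :=
  G.endAt x e = u ∧ G.endAt x.opp e = G.endAt y f ∧
    u ≠ G.endAt y f ∧ G.endAt y f ≠ G.endAt y.opp f ∧ u ≠ G.endAt y.opp f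

/-- A wedge of type `xy` with head `u` and second edge `f` is `z`-closed if some edge joins the
head `u` and the tail and has direction `z` relative to the head. -/
def IsClosedBy (G : DirMultigraph V E) (y z : Dir) (u : V) (f : E) : Prop :=
  ∃ g : E, G.endAt z g = u ∧ G.endAt z.opp g = G.endAt y.opp f

instance [DecidableEq V] (G : DirMultigraph V E) (x y : Dir) (u : V) (e f : E) :
    Decidable (G.IsWedge x y u e f) := by
  unfold IsWedge; infer_instance

instance [DecidableEq V] [Fintype E] (G : DirMultigraph V E) (y z : Dir) (u : V) (f : E) :
    Decidable (G.IsClosedBy y z u f) := by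
  unfold IsClosedBy; infer_instance

variable [DecidableEq V] [Fintype E]

/-- Number of wedges of type `xy` with head `u`. -/
def wedgesAt (G : DirMultigraph V E) (x y : Dir) (u : V) : ℕ :=
  (Finset.univ.filter fun p : E × E => G.IsWedge x y u p.1 p.2).card

/-- Number of `z`-closed wedges of type `xy` with head `u`. -/
def closedWedgesAt (G : DirMultigraph V E) (x y z : Dir) (u : V) : ℕ :=
  (Finset.univ.filter fun p : E × E =>
    G.IsWedge x y u p.1 p.2 ∧ G.IsClosedBy y z u p.2).card

/-- Total number of wedges of type `xy`. -/
def wedges [Fintype V] (G : DirMultigraph V E) (x y : Dir) : ℕ :=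
  ∑ u : V, G.wedgesAt x y u

/-- Total number of `z`-closed wedges of type `xy`. -/
def closedWedges [Fintype V] (G : DirMultigraph V E) (x y z : Dir) : ℕ :=
  ∑ u : V, G.closedWedgesAt x y z u

/-- The global directed closure coefficient: the fraction of the wedges of type `xy` that are
`z`-closed (with value `0` if there is no wedge of type `xy`). -/
noncomputable def globalClosure [Fintype V] (G : DirMultigraph V E) (x y z : Dir) : ℝ :=
  (G.closedWedges x y z : ℝ) / (G.wedges x y : ℝ)

end DirMultigraph

/-- A joint degree sequence on the node set `V`: an in-degree `deg .i u` and an out-degree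
`deg .o u` for every node `u`, with equal sums. -/
structure JointDegSeq (V : Type*) [Fintype V] where
  deg : Dir → V → ℕ
  sum_eq : ∑ u, deg .i u = ∑ u, deg .o u

namespace JointDegSeq

variable {V : Type*} [Fintype V]

/-- The number of edges. -/
def m (S : JointDegSeq V) : ℕ := ∑ u, S.deg .i u

/-- The second-order moments of the degree sequence. -/
noncomputable def M (S : JointDegSeq V) (a b : Dir) : ℝ :=
  (1 / (Fintype.card V : ℝ)) * ∑ u, (S.deg a u : ℝ) * (S.deg b u : ℝ)

/-- The number of ordered pairs of different stubs at `u`, the first of direction `a` and the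
second of direction `b`. -/
def stubPairs (S : JointDegSeq V) (a b : Dir) (u : V) : ℝ :=
  (S.deg a u : ℝ) * ((S.deg b u : ℝ) - if a = b then 1 else 0)

/-- The stubs (half-edges) of direction `a`: the node `u` has `deg a u` of them. -/
abbrev Stub (S : JointDegSeq V) (a : Dir) : Type _ := Σ u : V, Fin (S.deg a u)

/-- The directed multigraph obtained by matching every outgoing stub with an incoming stub. -/
def graph (S : JointDegSeq V) (σ : S.Stub .o ≃ S.Stub .i) : DirMultigraph V (S.Stub .o) where
  src p := p.1
  tgt p := (σ p).1

/-- Expectation of `f G` for `G` sampled from the directed configuration model with joint degree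
sequence `S`, in which the matching of outgoing with incoming stubs is uniformly random. -/
noncomputable def expectation [DecidableEq V] (S : JointDegSeq V)
    (f : DirMultigraph V (S.Stub .o) → ℝ) : ℝ :=
  𝔼 σ : S.Stub .o ≃ S.Stub .i, f (S.graph σ)

end JointDegSeq

namespace JointDegSeq

open Finset

/-! A wedge of type `xy` is a pair of half-edges at its center. The number of such pairs, `W =
(S.pairs x.opp y).card`, does not depend on the matching, and the number of wedges is `W - D`, where
`D` counts the degenerate pairs (`wedges_add_degenerates`). A closed wedge with a chosen closing
edge is a triple of pairs of half-edges, at center, head and tail. Since no node dominates the heads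
or tails, almost all of the `W * A * B` triples have three different nodes (`le_card_triangles`),
where `A` and `B` are the numbers of pairs at heads and at tails. Each such triple fixes three
edges, so it occurs with probability `(m - 3)! / m!`, about `1 / m ^ 3`. If the denominator were
`W`, the closure coefficient would have mean about `A * B / m ^ 3`, and by `moment_formula` this is
the claimed expression.

The lower bound uses that there are never more than `W` wedges, together with Bonferroni's
inequality for wedges closed more than once (`le_closedWedges`). The upper bound sums the inverse of
`W - D` over the matchings that contain a given triple (`sum_inv_le`). There `W - D` is at least 1,
because the triple itself supplies a wedge, and the first and third moments of `D` show that the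
conditional mean of the inverse is at most `(1 + O(Δ ^ 2 / m)) / W`, where `Δ` is the maximum
degree. No lower bound on `W` is needed beyond `W > 0`.

The moments come from revealing the matching one edge at a time: a half-edge not yet matched is
joined to a given node with probability at most `δ`, of order `Δ / m` (`card_mate_node_le`). -/

instance : Fintype Dir := ⟨{.i, .o}, by rintro (_ | _) <;> simp⟩

@[simp] lemma _root_.Dir.opp_opp (a : Dir) : a.opp.opp = a := by cases a <;> rfl

lemma _root_.Dir.opp_inj {a b : Dir} : a.opp = b.opp ↔ a = b := by
  cases a <;> cases b <;> simp [Dir.opp]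

variable {V : Type*} [Fintype V]

/-! ### Half-edges, their mates and their edges. -/

/-- The half-edges of all directions. -/
abbrev HalfEdge (S : JointDegSeq V) : Type _ := Σ a : Dir, S.Stub a

/-- The matchings of outgoing with incoming stubs. -/
abbrev Matching (S : JointDegSeq V) : Type _ := S.Stub .o ≃ S.Stub .i

variable {S : JointDegSeq V}

/-- The node at which a half-edge is attached. -/
def node (h : S.HalfEdge) : V := h.2.1

/-- The other half of the edge that contains a given half-edge. -/
def mate (σ : S.Matching) : S.HalfEdge → S.HalfEdge
  | ⟨.o, s⟩ => ⟨.i, σ s⟩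
  | ⟨.i, s⟩ => ⟨.o, σ.symm s⟩

/-- The edge that contains a given half-edge. -/
def edge (σ : S.Matching) : S.HalfEdge → S.Stub .o
  | ⟨.o, s⟩ => s
  | ⟨.i, s⟩ => σ.symm s

/-- The half of direction `a` of an edge. -/
def half (σ : S.Matching) : Dir → S.Stub .o → S.HalfEdge
  | .o, s => ⟨.o, s⟩
  | .i, s => ⟨.i, σ s⟩

@[simp] lemma edge_half (σ : S.Matching) (a : Dir) (e : S.Stub .o) : edge σ (half σ a e) = e := by
  cases a <;> simp [edge, half]

@[simp] lemma half_edge (σ : S.Matching) (h : S.HalfEdge) : half σ h.1 (edge σ h) = h := by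
  rcases h with ⟨_ | _, s⟩ <;> simp [edge, half]

@[simp] lemma half_fst (σ : S.Matching) (a : Dir) (e : S.Stub .o) : (half σ a e).1 = a := by
  cases a <;> rfl

lemma mate_half (σ : S.Matching) (a : Dir) (e : S.Stub .o) :
    mate σ (half σ a e) = half σ a.opp e := by
  cases a <;> simp [mate, half, Dir.opp]

@[simp] lemma mate_mate (σ : S.Matching) (h : S.HalfEdge) : mate σ (mate σ h) = h := by
  rcases h with ⟨_ | _, s⟩ <;> simp [mate]

@[simp] lemma mate_fst (σ : S.Matching) (h : S.HalfEdge) : (mate σ h).1 = h.1.opp := by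
  rcases h with ⟨_ | _, s⟩ <;> rfl

@[simp] lemma edge_mate (σ : S.Matching) (h : S.HalfEdge) : edge σ (mate σ h) = edge σ h := by
  rcases h with ⟨_ | _, s⟩ <;> simp [mate, edge]

lemma endAt_graph (σ : S.Matching) (a : Dir) (e : S.Stub .o) :
    (S.graph σ).endAt a e = node (half σ a e) := by
  cases a <;> rfl

lemma edge_eq_iff (σ : S.Matching) (h g : S.HalfEdge) :
    edge σ h = edge σ g ↔ h = g ∨ h = mate σ g := by
  constructor
  · intro e
    by_cases hd : h.1 = g.1
    · left
      rw [← half_edge σ h, ← half_edge σ g, e, hd]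
    · right
      have : h.1 = (mate σ g).1 := by
        rw [mate_fst]
        revert hd
        generalize h.1 = a
        generalize g.1 = b
        cases a <;> cases b <;> simp [Dir.opp]
      rw [← half_edge σ h, ← half_edge σ (mate σ g), e, edge_mate, this]
  · rintro (rfl | rfl) <;> simp

/-- Turns agreement of mates, for either direction, into agreement of two bijections at an outgoing
stub. -/
lemma mate_eq_mate_iff (σ τ : S.Matching) (h : S.HalfEdge) :
    mate σ h = mate τ h ↔ σ (edge τ h) = τ (edge τ h) := by
  rcases h with ⟨_ | _, s⟩
  · simp [mate, edge, Equiv.symm_apply_eq, eq_comm]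
  · simp [mate, edge]

lemma edge_eq_of_mate_eq {σ τ : S.Matching} {h : S.HalfEdge} (H : mate σ h = mate τ h) :
    edge σ h = edge τ h := by
  rcases h with ⟨_ | _, s⟩
  · simpa [mate, edge] using H
  · rfl

lemma mate_eq_of_edge_eq {σ τ : S.Matching} {h g : S.HalfEdge} (H : mate σ h = mate τ h)
    (e : edge τ g = edge τ h) : mate σ g = mate τ g := by
  rw [mate_eq_mate_iff] at H ⊢
  rwa [e]

lemma card_stub (a : Dir) : Fintype.card (S.Stub a) = S.m := by
  cases a
  · simp [m]
  · simp [m, S.sum_eq]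

lemma sum_deg (a : Dir) : ∑ u, S.deg a u = S.m := by
  rw [← card_stub (S := S) a]; simp

lemma nonempty_matching (S : JointDegSeq V) : Nonempty S.Matching :=
  ⟨Fintype.equivOfCardEq (by rw [card_stub, card_stub])⟩

/-- The correction by `m / n` removes the pairings of a stub with itself, of which there are `m` in
all when `a = b`. -/
lemma moment_formula (S : JointDegSeq V) [Nonempty V] (a b : Dir) :
    S.M a b - (if a = b then 1 else 0) * ((S.m : ℝ) / (Fintype.card V : ℝ)) =
      (∑ v, S.stubPairs a b v) / (Fintype.card V : ℝ) := by
  have hn : (Fintype.card V : ℝ) ≠ 0 := by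
    exact_mod_cast Fintype.card_ne_zero
  have h : ∑ v, S.stubPairs a b v =
      ∑ v, (S.deg a v : ℝ) * S.deg b v - (if a = b then 1 else 0) * S.m := by
    rw [← sum_deg a, Nat.cast_sum, mul_sum, ← sum_sub_distrib]
    exact sum_congr rfl fun v _ => by rw [stubPairs]; ring
  rw [h, M]
  field_simp

/-- In the matching `σ`, the two edges at a pair of half-edges at a common node do not form a path
on three different nodes. -/
def Degenerate (σ : S.Matching) (p : S.HalfEdge × S.HalfEdge) : Prop :=
  node (mate σ p.1) = node p.1 ∨ node (mate σ p.2) = node p.2 ∨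
    node (mate σ p.1) = node (mate σ p.2)

lemma degenerate_congr {σ τ : S.Matching} {p : S.HalfEdge × S.HalfEdge}
    (h1 : mate σ p.1 = mate τ p.1) (h2 : mate σ p.2 = mate τ p.2) :
    Degenerate σ p ↔ Degenerate τ p := by simp [Degenerate, h1, h2]

/-! ### Conditioning on the mates of finitely many half-edges. -/

variable [DecidableEq V]

/-- The matchings in which the half-edges in `Q` have the same mates as in `τ`. -/
def agree (τ : S.Matching) (Q : Finset S.HalfEdge) : Finset S.Matching :=
  univ.filter fun σ => ∀ h ∈ Q, mate σ h = mate τ h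

@[simp] lemma mem_agree {τ σ : S.Matching} {Q : Finset S.HalfEdge} :
    σ ∈ agree τ Q ↔ ∀ h ∈ Q, mate σ h = mate τ h := by simp [agree]

lemma self_mem_agree (τ : S.Matching) (Q : Finset S.HalfEdge) : τ ∈ agree τ Q := by simp

lemma agree_empty (τ : S.Matching) : agree τ ∅ = univ := by ext; simp

/-- The edges that contain a half-edge in `Q`. -/
def edges (τ : S.Matching) (Q : Finset S.HalfEdge) : Finset (S.Stub .o) := Q.image (edge τ)

lemma edges_insert (τ : S.Matching) (h : S.HalfEdge) (Q : Finset S.HalfEdge) :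
    edges τ (insert h Q) = insert (edge τ h) (edges τ Q) := by simp [edges, image_insert]

lemma card_edges_le (τ : S.Matching) (Q : Finset S.HalfEdge) : (edges τ Q).card ≤ Q.card :=
  card_image_le

lemma edges_eq_of_mem_agree {τ σ : S.Matching} {Q : Finset S.HalfEdge} (hσ : σ ∈ agree τ Q) :
    edges σ Q = edges τ Q :=
  image_congr fun h hh => edge_eq_of_mate_eq (mem_agree.1 hσ h hh)

lemma mate_eq_of_mem_edges {τ σ : S.Matching} {Q : Finset S.HalfEdge} {h : S.HalfEdge}
    (hσ : σ ∈ agree τ Q) (hh : edge τ h ∈ edges τ Q) : mate σ h = mate τ h := by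
  obtain ⟨q, hq, e⟩ := mem_image.1 hh
  exact mate_eq_of_edge_eq (mem_agree.1 hσ q hq) e.symm

lemma edge_mem_edges_iff {τ σ : S.Matching} {Q : Finset S.HalfEdge} (h : S.HalfEdge)
    (hσ : σ ∈ agree τ Q) : edge σ h ∈ edges σ Q ↔ edge τ h ∈ edges τ Q := by
  have hτ : τ ∈ agree σ Q := mem_agree.2 fun q hq => (mem_agree.1 hσ q hq).symm
  constructor
  · intro H
    rw [← edges_eq_of_mem_agree hσ, edge_eq_of_mate_eq (mate_eq_of_mem_edges hτ H)]
    exact H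
  · intro H
    rw [edges_eq_of_mem_agree hσ, edge_eq_of_mate_eq (mate_eq_of_mem_edges hσ H)]
    exact H

/-- Revealing one more mate splits a conditioning class into classes of the same kind, so
conditioning can be iterated. -/
lemma agree_insert_eq {τ σ : S.Matching} {Q : Finset S.HalfEdge} (h : S.HalfEdge)
    (hσ : σ ∈ agree τ Q) :
    agree σ (insert h Q) = (agree τ Q).filter fun ρ => mate ρ h = mate σ h := by
  ext ρ
  simp only [mem_agree, mem_insert, forall_eq_or_imp, mem_filter]
  rw [and_comm]
  refine and_congr_left fun _ => forall₂_congr fun q hq => ?_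
  rw [mem_agree.1 hσ q hq]

/-- Composition with the inverse of `τ` gives the permutations that fix every edge of `Q`; these
permute the other edges freely. -/
theorem card_agree (τ : S.Matching) (Q : Finset S.HalfEdge) :
    (agree τ Q).card = (S.m - (edges τ Q).card).factorial := by
  have e1 : {σ : S.Matching // σ ∈ agree τ Q} ≃
      {π : Equiv.Perm (S.Stub .o) // ∀ a, ¬ (a ∉ edges τ Q) → π a = a} :=
    { toFun := fun σ => ⟨σ.1.trans τ.symm, by
        intro a ha
        obtain ⟨q, hq, rfl⟩ := mem_image.1 (not_not.1 ha)
        have := (mate_eq_mate_iff _ _ _).1 (mem_agree.1 σ.2 q hq)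
        simp [this]⟩
      invFun := fun π => ⟨π.1.trans τ, by
        rw [mem_agree]
        intro q hq
        rw [mate_eq_mate_iff]
        have := π.2 (edge τ q) (not_not.2 (mem_image_of_mem _ hq))
        simp [this]⟩
      left_inv := fun σ => by ext1; ext1 s; simp
      right_inv := fun π => by ext1; ext1 s; simp }
  have := Fintype.card_congr (e1.trans (Equiv.Perm.subtypeEquivSubtypePerm (· ∉ edges τ Q)).symm)
  rw [Fintype.card_coe, Fintype.card_perm, Fintype.card_subtype_compl, card_stub,
    Fintype.card_coe] at this
  exact this

lemma card_matching (τ : S.Matching) : Fintype.card S.Matching = S.m.factorial := by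
  rw [← card_univ, ← agree_empty τ, card_agree]; simp [edges]

lemma card_edges_insert {τ : S.Matching} {Q : Finset S.HalfEdge} {h : S.HalfEdge}
    (hh : edge τ h ∉ edges τ Q) : (edges τ (insert h Q)).card = (edges τ Q).card + 1 := by
  rw [edges_insert, card_insert_of_notMem hh]

lemma card_edges_lt {τ : S.Matching} {Q : Finset S.HalfEdge} {h : S.HalfEdge}
    (hh : edge τ h ∉ edges τ Q) : (edges τ Q).card < S.m := by
  rw [← card_stub (S := S) .o]
  exact Finset.card_lt_univ_of_notMem hh

lemma card_agree_insert {τ : S.Matching} {Q : Finset S.HalfEdge} {h : S.HalfEdge}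
    (hh : edge τ h ∉ edges τ Q) :
    ((agree τ Q).card : ℝ) = (S.m - (edges τ Q).card) * (agree τ (insert h Q)).card := by
  rw [card_agree, card_agree, card_edges_insert hh]
  have h1 := card_edges_lt hh
  obtain ⟨k, hk⟩ : ∃ k, S.m - (edges τ Q).card = k + 1 := ⟨S.m - (edges τ Q).card - 1, by omega⟩
  have h2 : S.m - ((edges τ Q).card + 1) = k := by omega
  rw [← Nat.cast_sub h1.le, h2, hk, Nat.factorial_succ]
  push_cast
  ring

/-- The tower property: averages over `agree τ Q` may be compared after conditioning on the
mate of a further half-edge. -/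
lemma sum_agree_le_of_insert {τ : S.Matching} {Q : Finset S.HalfEdge} (h : S.HalfEdge)
    {f g : S.Matching → ℝ}
    (H : ∀ σ ∈ agree τ Q,
      ∑ ρ ∈ agree σ (insert h Q), f ρ ≤ ∑ ρ ∈ agree σ (insert h Q), g ρ) :
    ∑ ρ ∈ agree τ Q, f ρ ≤ ∑ ρ ∈ agree τ Q, g ρ := by
  rw [← sum_fiberwise (agree τ Q) (fun ρ => mate ρ h) f,
    ← sum_fiberwise (agree τ Q) (fun ρ => mate ρ h) g]
  refine sum_le_sum fun k _ => ?_
  rcases ((agree τ Q).filter fun ρ => mate ρ h = k).eq_empty_or_nonempty with h0 | ⟨σ, hσ⟩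
  · rw [h0]; simp
  · obtain ⟨h1, rfl⟩ := mem_filter.1 hσ
    rw [← agree_insert_eq h h1]
    exact H σ h1

/-! ### Probability that a half-edge is joined to a given node. -/

/-- The half-edges of direction `a` at the node `v`. -/
def star (S : JointDegSeq V) (a : Dir) (v : V) : Finset S.HalfEdge :=
  univ.filter fun h => h.1 = a ∧ node h = v

@[simp] lemma mem_star {a : Dir} {v : V} {h : S.HalfEdge} :
    h ∈ S.star a v ↔ h.1 = a ∧ node h = v := by simp [star]

lemma card_star (a : Dir) (v : V) : (S.star a v).card = S.deg a v := by
  have : S.star a v =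
      (univ : Finset (Fin (S.deg a v))).map
        ⟨fun j => (⟨a, ⟨v, j⟩⟩ : S.HalfEdge), fun j k h => by simpa using h⟩ := by
    ext ⟨b, w, j⟩
    simp only [mem_star, node, Finset.mem_map, mem_univ, true_and]
    constructor
    · rintro ⟨rfl, rfl⟩
      exact ⟨j, rfl⟩
    · rintro ⟨k, hk⟩
      cases hk
      exact ⟨rfl, rfl⟩
  rw [this, card_map, card_univ, Fintype.card_fin]

/-- A nonempty fibre is a conditioning class with exactly one more known edge, which gives equality;
a half-edge that cannot be the mate gives an empty fibre. -/
lemma sum_agree_mate_eq_le {τ : S.Matching} {Q : Finset S.HalfEdge} {h : S.HalfEdge}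
    (hh : edge τ h ∉ edges τ Q) (k : S.HalfEdge) :
    (S.m - (edges τ Q).card : ℝ) * ((agree τ Q).filter fun σ => mate σ h = k).card ≤
      (agree τ Q).card := by
  rcases ((agree τ Q).filter fun ρ => mate ρ h = k).eq_empty_or_nonempty with h0 | ⟨σ, hσ⟩
  · rw [h0]; simp
  · obtain ⟨h1, rfl⟩ := mem_filter.1 hσ
    rw [← agree_insert_eq h h1]
    have h2 : edge σ h ∉ edges σ Q := by rwa [edge_mem_edges_iff h h1]
    have h3 := card_agree_insert h2
    have h4 : (agree σ Q).card = (agree τ Q).card := by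
      rw [card_agree, card_agree, edges_eq_of_mem_agree h1]
    rw [← h4, h3, edges_eq_of_mem_agree h1]

/-- Given the mates of the half-edges in `Q`, another half-edge is joined to a node of degree at
most `Δ` with probability at most `δ`. -/
lemma card_mate_node_le {τ : S.Matching} {Q : Finset S.HalfEdge} {h : S.HalfEdge}
    (hh : edge τ h ∉ edges τ Q) {Δ : ℕ} (hΔ : ∀ a u, S.deg a u ≤ Δ) {δ : ℝ}
    (hδ : (Δ : ℝ) ≤ δ * (S.m - (edges τ Q).card)) (v : V) :
    (((agree τ Q).filter fun σ => node (mate σ h) = v).card : ℝ) ≤ δ * (agree τ Q).card := by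
  have hpos : (0 : ℝ) < S.m - (edges τ Q).card := by
    have := card_edges_lt hh
    rw [sub_pos]; exact_mod_cast this
  have h1 : (((agree τ Q).filter fun σ => node (mate σ h) = v).card : ℝ) ≤
      ∑ k ∈ S.star h.1.opp v, (((agree τ Q).filter fun σ => mate σ h = k).card : ℝ) := by
    have : ((agree τ Q).filter fun σ => node (mate σ h) = v) ⊆
        (S.star h.1.opp v).biUnion fun k => (agree τ Q).filter fun σ => mate σ h = k := by
      intro σ hσ
      simp only [mem_filter, mem_biUnion, mem_star] at hσ ⊢
      exact ⟨mate σ h, ⟨mate_fst σ h, hσ.2⟩, hσ.1, rfl⟩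
    exact_mod_cast (card_le_card this).trans card_biUnion_le
  have h2 : (S.m - (edges τ Q).card : ℝ) *
      ((agree τ Q).filter fun σ => node (mate σ h) = v).card ≤ Δ * (agree τ Q).card := by
    calc _ ≤ (S.m - (edges τ Q).card : ℝ) *
          ∑ k ∈ S.star h.1.opp v, (((agree τ Q).filter fun σ => mate σ h = k).card : ℝ) := by
            gcongr
      _ ≤ ∑ k ∈ S.star h.1.opp v, ((agree τ Q).card : ℝ) := by
            rw [mul_sum]
            exact sum_le_sum fun k _ => sum_agree_mate_eq_le hh k
      _ = (S.deg h.1.opp v : ℝ) * (agree τ Q).card := by rw [sum_const, card_star, nsmul_eq_mul]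
      _ ≤ _ := by
            gcongr
            exact hΔ _ _
  have h3 : (Δ : ℝ) * (agree τ Q).card ≤
      (S.m - (edges τ Q).card : ℝ) * (δ * (agree τ Q).card) := by
    calc (Δ : ℝ) * (agree τ Q).card ≤ δ * (S.m - (edges τ Q).card) * (agree τ Q).card := by gcongr
      _ = _ := by ring
  exact le_of_mul_le_mul_left (h2.trans h3) hpos

/-! ### Pairs of half-edges at a common node. -/

/-- The ordered pairs of different half-edges at the node `v`, the first of direction `a` and the
second of direction `b`. -/
def pairsAt (S : JointDegSeq V) (a b : Dir) (v : V) : Finset (S.HalfEdge × S.HalfEdge) :=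
  (S.star a v ×ˢ S.star b v).filter fun p => p.1 ≠ p.2

/-- The ordered pairs of different half-edges at a common node, the first of direction `a` and the
second of direction `b`. -/
def pairs (S : JointDegSeq V) (a b : Dir) : Finset (S.HalfEdge × S.HalfEdge) :=
  univ.filter fun p => p.1 ≠ p.2 ∧ node p.1 = node p.2 ∧ p.1.1 = a ∧ p.2.1 = b

lemma mem_pairsAt {a b : Dir} {v : V} {p : S.HalfEdge × S.HalfEdge} :
    p ∈ S.pairsAt a b v ↔ p ∈ S.pairs a b ∧ node p.1 = v := by
  simp only [pairsAt, pairs, mem_filter, mem_product, mem_star, mem_univ, true_and]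
  constructor
  · rintro ⟨⟨⟨h1, h2⟩, h3, h4⟩, h5⟩
    exact ⟨⟨h5, h2.trans h4.symm, h1, h3⟩, h2⟩
  · rintro ⟨⟨h5, h2, h1, h3⟩, h4⟩
    exact ⟨⟨⟨h1, h4⟩, h3, h2 ▸ h4⟩, h5⟩

lemma mem_pairs {a b : Dir} {p : S.HalfEdge × S.HalfEdge} :
    p ∈ S.pairs a b ↔ p.1 ≠ p.2 ∧ node p.1 = node p.2 ∧ p.1.1 = a ∧ p.2.1 = b := by
  simp [pairs]

lemma card_pairsAt (a b : Dir) (v : V) : ((S.pairsAt a b v).card : ℝ) = S.stubPairs a b v := by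
  by_cases hab : a = b
  · subst hab
    have : S.pairsAt a a v = (S.star a v).offDiag := by
      ext p
      simp only [pairsAt, mem_filter, mem_product, mem_offDiag, and_assoc]
    rw [this, offDiag_card, card_star, Nat.cast_sub (Nat.le_mul_self _)]
    simp [stubPairs]
    ring
  · have : S.pairsAt a b v = S.star a v ×ˢ S.star b v := by
      refine filter_true_of_mem fun p hp e => hab ?_
      simp only [mem_product, mem_star] at hp
      rw [← hp.1.1, ← hp.2.1, e]
    rw [this, card_product, card_star, card_star]
    simp [stubPairs, hab]

lemma sum_pairs (a b : Dir) (f : S.HalfEdge × S.HalfEdge → ℝ) :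
    ∑ p ∈ S.pairs a b, f p = ∑ v, ∑ p ∈ S.pairsAt a b v, f p := by
  rw [← sum_fiberwise (S.pairs a b) (fun p => node p.1) f]
  refine sum_congr rfl fun v _ => sum_congr ?_ fun _ _ => rfl
  ext p
  simp [mem_pairsAt]

lemma card_pairs (a b : Dir) : ((S.pairs a b).card : ℝ) = ∑ v, S.stubPairs a b v := by
  have := sum_pairs (S := S) a b fun _ => 1
  simpa [card_pairsAt] using this

instance (σ : S.Matching) (p : S.HalfEdge × S.HalfEdge) : Decidable (Degenerate σ p) := by
  unfold Degenerate; infer_instance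

/-- The pairs of half-edges in `P` that are degenerate in `σ`. -/
def degenerates (P : Finset (S.HalfEdge × S.HalfEdge)) (σ : S.Matching) :
    Finset (S.HalfEdge × S.HalfEdge) := P.filter (Degenerate σ)

lemma sum_ite_eq_card {α : Type*} (s : Finset α) (p : α → Prop) [DecidablePred p] :
    ∑ x ∈ s, (if p x then (1 : ℝ) else 0) = (s.filter p).card := by simp

/-! ### Conditional moments of the number of degenerate pairs. -/

section bounds

variable {Δ : ℕ} {δ : ℝ}

/-- At most eight edges are ever known: three of a closed wedge, four of two pairs already revealed,
and one of the pair being examined. -/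
lemma le_mul_sub_card {τ : S.Matching} {Q : Finset S.HalfEdge} (hδ0 : 0 ≤ δ)
    (hδ : (Δ : ℝ) ≤ δ * (S.m - 8)) (hQ : (edges τ Q).card ≤ 8) :
    (Δ : ℝ) ≤ δ * (S.m - (edges τ Q).card) := by
  refine hδ.trans (mul_le_mul_of_nonneg_left ?_ hδ0)
  have : ((edges τ Q).card : ℝ) ≤ 8 := by exact_mod_cast hQ
  linarith

lemma card_degenerate_le_of_unknown (hΔ : ∀ a u, S.deg a u ≤ Δ) (hδ0 : 0 ≤ δ)
    (hδ : (Δ : ℝ) ≤ δ * (S.m - 8)) {τ : S.Matching} {Q : Finset S.HalfEdge}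
    (hQ : (edges τ Q).card ≤ 7) {p : S.HalfEdge × S.HalfEdge} (hne : p.1 ≠ p.2)
    (hp : node p.1 = node p.2)
    (h1 : edge τ p.1 ∉ edges τ Q) (h2 : edge τ p.2 ∉ edges τ Q) :
    (((agree τ Q).filter fun σ => Degenerate σ p).card : ℝ) ≤ 3 * δ * (agree τ Q).card := by
  have hb1 := card_mate_node_le h1 hΔ (le_mul_sub_card hδ0 hδ (by omega)) (node p.1)
  have hb2 := card_mate_node_le h2 hΔ (le_mul_sub_card hδ0 hδ (by omega)) (node p.2)
  -- Loops at `p.1` are excluded here so that revealing the mate of `p.1` cannot reveal that of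
  -- `p.2`: the two half-edges share an edge only if it is a loop.
  have hb3 : (((agree τ Q).filter fun σ => node (mate σ p.1) ≠ node p.1 ∧
      node (mate σ p.2) = node (mate σ p.1)).card : ℝ) ≤ δ * (agree τ Q).card := by
    rw [← sum_ite_eq_card, mul_comm, ← nsmul_eq_mul, ← sum_const]
    refine sum_agree_le_of_insert p.1 fun σ hσ => ?_
    rw [sum_const, nsmul_eq_mul, mul_comm, sum_ite_eq_card]
    by_cases hl : node (mate σ p.1) = node p.1
    · rw [filter_false_of_mem]
      · simpa using by positivity
      · intro ρ hρ
        rw [mem_agree.1 hρ p.1 (mem_insert_self _ _)]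
        simp [hl]
    · have hu : edge σ p.2 ∉ edges σ (insert p.1 Q) := by
        rw [edges_insert, mem_insert, not_or, edge_mem_edges_iff _ hσ, edge_eq_iff]
        refine ⟨?_, h2⟩
        rintro (h | h)
        · exact hne h.symm
        · exact hl (by rw [← h, hp])
      have hc : (edges σ (insert p.1 Q)).card ≤ 8 := by
        rw [edges_insert, edges_eq_of_mem_agree hσ]
        exact (card_insert_le _ _).trans (by omega)
      refine le_trans ?_ (card_mate_node_le hu hΔ (le_mul_sub_card hδ0 hδ hc) (node (mate σ p.1)))
      refine Nat.cast_le.2 (card_le_card fun ρ hρ => ?_)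
      rw [mem_filter] at hρ ⊢
      refine ⟨hρ.1, ?_⟩
      rw [hρ.2.2, mem_agree.1 hρ.1 p.1 (mem_insert_self _ _)]
  have hsub : ((agree τ Q).filter fun σ => Degenerate σ p) ⊆
      ((agree τ Q).filter fun σ => node (mate σ p.1) = node p.1) ∪
      (((agree τ Q).filter fun σ => node (mate σ p.2) = node p.2) ∪
      ((agree τ Q).filter fun σ => node (mate σ p.1) ≠ node p.1 ∧
        node (mate σ p.2) = node (mate σ p.1))) := by
    intro σ hσ
    simp only [mem_union, mem_filter, Degenerate] at hσ ⊢
    grind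
  have := (card_le_card hsub).trans ((card_union_le _ _).trans
    (Nat.add_le_add_left (card_union_le _ _) _))
  have : (((agree τ Q).filter fun σ => Degenerate σ p).card : ℝ) ≤ _ := Nat.cast_le.2 this
  push_cast at this
  linarith

/-- Among the half-edges whose mates are fixed by the mates of `Q` in `τ` there are no loops and
no two half-edges at a common node whose mates have a common node. -/
def Clean (τ : S.Matching) (Q : Finset S.HalfEdge) : Prop :=
  (∀ h, edge τ h ∈ edges τ Q → node (mate τ h) ≠ node h) ∧
  ∀ h g, edge τ h ∈ edges τ Q → edge τ g ∈ edges τ Q → h ≠ g → node h = node g →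
    node (mate τ h) ≠ node (mate τ g)

/-- If both edges are known, cleanness rules out degeneracy. If one is known, the other mate must
fall on one of two nodes. Hence no pair is degenerate merely because its edges are known. -/
lemma card_degenerate_le_of_clean (hΔ : ∀ a u, S.deg a u ≤ Δ) (hδ0 : 0 ≤ δ)
    (hδ : (Δ : ℝ) ≤ δ * (S.m - 8)) {τ : S.Matching} {Q : Finset S.HalfEdge}
    (hQ : (edges τ Q).card ≤ 7) (hc : Clean τ Q) {p : S.HalfEdge × S.HalfEdge} (hne : p.1 ≠ p.2)
    (hp : node p.1 = node p.2) :
    (((agree τ Q).filter fun σ => Degenerate σ p).card : ℝ) ≤ 3 * δ * (agree τ Q).card := by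
  have hpos : (0 : ℝ) ≤ δ * (agree τ Q).card := by positivity
  have hδ' := le_mul_sub_card hδ0 hδ (show (edges τ Q).card ≤ 8 by omega)
  have key : ∀ h v w, edge τ h ∉ edges τ Q →
      (((agree τ Q).filter fun σ => node (mate σ h) = v ∨ node (mate σ h) = w).card : ℝ) ≤
        3 * δ * (agree τ Q).card := by
    intro h v w hh
    have hb1 := card_mate_node_le hh hΔ hδ' v
    have hb2 := card_mate_node_le hh hΔ hδ' w
    rw [filter_or]
    have : ((((agree τ Q).filter fun σ => node (mate σ h) = v) ∪
      ((agree τ Q).filter fun σ => node (mate σ h) = w)).card : ℝ) ≤ _ :=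
      Nat.cast_le.2 (card_union_le _ _)
    push_cast at this
    linarith
  by_cases h1 : edge τ p.1 ∈ edges τ Q
  · by_cases h2 : edge τ p.2 ∈ edges τ Q
    · rw [filter_false_of_mem]
      · simpa using by positivity
      · intro σ hσ
        rw [Degenerate, mate_eq_of_mem_edges hσ h1, mate_eq_of_mem_edges hσ h2]
        have := hc.1 _ h1
        have := hc.1 _ h2
        have := hc.2 _ _ h1 h2 hne hp
        tauto
    · refine le_trans (Nat.cast_le.2 (card_le_card fun σ hσ => ?_))
        (key p.2 (node p.2) (node (mate τ p.1)) h2)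
      rw [mem_filter] at hσ ⊢
      refine ⟨hσ.1, ?_⟩
      have h3 := hσ.2
      rw [Degenerate, mate_eq_of_mem_edges hσ.1 h1] at h3
      have := hc.1 _ h1
      grind
  · by_cases h2 : edge τ p.2 ∈ edges τ Q
    · refine le_trans (Nat.cast_le.2 (card_le_card fun σ hσ => ?_))
        (key p.1 (node p.1) (node (mate τ p.2)) h1)
      rw [mem_filter] at hσ ⊢
      refine ⟨hσ.1, ?_⟩
      have h3 := hσ.2
      rw [Degenerate, mate_eq_of_mem_edges hσ.1 h2] at h3
      have := hc.1 _ h2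
      grind
    · exact card_degenerate_le_of_unknown hΔ hδ0 hδ hQ hne hp h1 h2

lemma sum_card_degenerates (P : Finset (S.HalfEdge × S.HalfEdge)) (s : Finset S.Matching) :
    ∑ σ ∈ s, ((degenerates P σ).card : ℝ) =
      ∑ p ∈ P, ((s.filter fun σ => Degenerate σ p).card : ℝ) := by
  simp only [degenerates, ← sum_ite_eq_card]
  exact sum_comm

lemma sum_degenerates_le_of_clean (hΔ : ∀ a u, S.deg a u ≤ Δ) (hδ0 : 0 ≤ δ)
    (hδ : (Δ : ℝ) ≤ δ * (S.m - 8)) {τ : S.Matching} {Q : Finset S.HalfEdge}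
    (hQ : (edges τ Q).card ≤ 7) (hc : Clean τ Q) (a b : Dir) :
    ∑ σ ∈ agree τ Q, ((degenerates (S.pairs a b) σ).card : ℝ) ≤
      3 * δ * (S.pairs a b).card * (agree τ Q).card := by
  rw [sum_card_degenerates]
  calc _ ≤ ∑ p ∈ S.pairs a b, 3 * δ * (agree τ Q).card := sum_le_sum fun p hp => by
        rw [mem_pairs] at hp
        exact card_degenerate_le_of_clean hΔ hδ0 hδ hQ hc hp.1 hp.2.1
    _ = _ := by rw [sum_const, nsmul_eq_mul]; ring

/-- An edge and the direction `a` determine the first half-edge, which has at most `Δ` partners. -/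
lemma card_pairs_fst_le (hΔ : ∀ a u, S.deg a u ≤ Δ) (τ : S.Matching) (E : Finset (S.Stub .o))
    (a b : Dir) : ((S.pairs a b).filter fun p => edge τ p.1 ∈ E).card ≤ E.card * Δ := by
  have : ((S.pairs a b).filter fun p => edge τ p.1 ∈ E) ⊆
      E.biUnion fun e => (S.star b (node (half τ a e))).image fun k => (half τ a e, k) := by
    rintro ⟨h, k⟩ hp
    simp only [mem_filter, mem_pairs, mem_biUnion, mem_image, mem_star] at hp ⊢
    obtain ⟨⟨-, h2, rfl, h4⟩, h5⟩ := hp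
    exact ⟨_, h5, k, ⟨h4, by simp [h2]⟩, by simp⟩
  refine (card_le_card this).trans (card_biUnion_le.trans ?_)
  rw [← smul_eq_mul]
  refine sum_le_card_nsmul _ _ _ fun e _ => card_image_le.trans ?_
  rw [card_star]
  exact hΔ _ _

lemma card_pairs_snd_le (hΔ : ∀ a u, S.deg a u ≤ Δ) (τ : S.Matching) (E : Finset (S.Stub .o))
    (a b : Dir) : ((S.pairs a b).filter fun p => edge τ p.2 ∈ E).card ≤ E.card * Δ := by
  refine le_trans (le_of_eq ?_) (card_pairs_fst_le hΔ τ E b a)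
  refine card_bij (fun p _ => p.swap) ?_ (fun p _ q _ h => Prod.swap_injective h) ?_
  · intro p hp
    simp only [mem_filter, mem_pairs, Prod.fst_swap, Prod.snd_swap] at hp ⊢
    tauto
  · intro p hp
    refine ⟨p.swap, ?_, Prod.swap_swap p⟩
    simp only [mem_filter, mem_pairs, Prod.fst_swap, Prod.snd_swap] at hp ⊢
    tauto

/-- Without cleanness a pair that meets a known edge may be degenerate for certain. There are at
most `7 * Δ` such pairs for each of the two coordinates, whence `14 * Δ`. -/
lemma sum_degenerates_le (hΔ : ∀ a u, S.deg a u ≤ Δ) (hδ0 : 0 ≤ δ)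
    (hδ : (Δ : ℝ) ≤ δ * (S.m - 8)) {τ : S.Matching} {Q : Finset S.HalfEdge}
    (hQ : (edges τ Q).card ≤ 7) (a b : Dir) :
    ∑ σ ∈ agree τ Q, ((degenerates (S.pairs a b) σ).card : ℝ) ≤
      (3 * δ * (S.pairs a b).card + 14 * Δ) * (agree τ Q).card := by
  rw [sum_card_degenerates]
  have h7 : ((edges τ Q).card : ℝ) * Δ ≤ 7 * Δ := by
    gcongr
    exact_mod_cast hQ
  have hc1 : (((S.pairs a b).filter fun p => edge τ p.1 ∈ edges τ Q).card : ℝ) ≤ 7 * Δ :=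
    le_trans (by exact_mod_cast card_pairs_fst_le hΔ τ (edges τ Q) a b) h7
  have hc2 : (((S.pairs a b).filter fun p => edge τ p.2 ∈ edges τ Q).card : ℝ) ≤ 7 * Δ :=
    le_trans (by exact_mod_cast card_pairs_snd_le hΔ τ (edges τ Q) a b) h7
  calc _ ≤ ∑ p ∈ S.pairs a b, (3 * δ + (if edge τ p.1 ∈ edges τ Q then 1 else 0) +
          (if edge τ p.2 ∈ edges τ Q then 1 else 0)) * (agree τ Q).card := by
        refine sum_le_sum fun p hp => ?_
        rw [mem_pairs] at hp
        have hle : (((agree τ Q).filter fun σ => Degenerate σ p).card : ℝ) ≤ (agree τ Q).card :=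
          Nat.cast_le.2 (card_filter_le _ _)
        have h0 : (0 : ℝ) ≤ δ * (agree τ Q).card := by positivity
        by_cases h1 : edge τ p.1 ∈ edges τ Q <;> by_cases h2 : edge τ p.2 ∈ edges τ Q
        · simp only [h1, h2, if_true]
          linarith
        · simp only [h1, h2, if_true, if_false]
          linarith
        · simp only [h1, h2, if_true, if_false]
          linarith
        · simpa only [h1, h2, if_false, add_zero] using
            card_degenerate_le_of_unknown hΔ hδ0 hδ hQ hp.1 hp.2.1 h1 h2
    _ ≤ _ := by
        rw [← sum_mul, sum_add_distrib, sum_add_distrib, sum_ite_eq_card, sum_ite_eq_card,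
          sum_const, nsmul_eq_mul]
        refine mul_le_mul_of_nonneg_right ?_ (Nat.cast_nonneg _)
        linarith

/-- Conditioning on the mates of a degenerate pair. -/
lemma sum_degenerate_mul_le {τ : S.Matching} {Q : Finset S.HalfEdge}
    (p : S.HalfEdge × S.HalfEdge) {f : S.Matching → ℝ} {K : ℝ}
    (H : ∀ σ ∈ agree τ Q, ∑ ρ ∈ agree σ (insert p.2 (insert p.1 Q)), f ρ ≤
      K * (agree σ (insert p.2 (insert p.1 Q))).card) :
    ∑ σ ∈ agree τ Q, (if Degenerate σ p then f σ else 0) ≤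
      K * ((agree τ Q).filter fun σ => Degenerate σ p).card := by
  rw [← sum_ite_eq_card, mul_sum]
  refine sum_agree_le_of_insert p.1 fun σ hσ => sum_agree_le_of_insert p.2 fun ρ hρ => ?_
  have hρ' : ρ ∈ agree τ Q := mem_agree.2 fun q hq => by
    rw [mem_agree.1 hρ q (mem_insert_of_mem hq), mem_agree.1 hσ q hq]
  have hag : ∀ π ∈ agree ρ (insert p.2 (insert p.1 Q)), Degenerate π p ↔ Degenerate ρ p :=
    fun π hπ => degenerate_congr (mem_agree.1 hπ _ (by simp)) (mem_agree.1 hπ _ (by simp))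
  by_cases hd : Degenerate ρ p
  · have e1 : ∀ π ∈ agree ρ (insert p.2 (insert p.1 Q)),
        (if Degenerate π p then f π else 0) = f π := fun π hπ => if_pos ((hag π hπ).2 hd)
    have e2 : ∀ π ∈ agree ρ (insert p.2 (insert p.1 Q)),
        K * (if Degenerate π p then 1 else 0) = K := fun π hπ => by
      rw [if_pos ((hag π hπ).2 hd), mul_one]
    rw [sum_congr rfl e1, sum_congr rfl e2, sum_const, nsmul_eq_mul, mul_comm _ K]
    exact H ρ hρ'
  · refine sum_le_sum fun π hπ => ?_
    have h : ¬ Degenerate π p := fun h => hd ((hag π hπ).1 h)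
    simp [h]

/-- Peels one factor off a moment of the number of degenerate pairs: that factor is a sum of
indicators, and revealing the pair of each adds two half-edges to `Q`. -/
lemma sum_degenerates_mul_le (P : Finset (S.HalfEdge × S.HalfEdge)) {τ : S.Matching}
    {Q : Finset S.HalfEdge} {f : S.Matching → ℝ} {K : ℝ}
    (H : ∀ Q' : Finset S.HalfEdge, Q'.card ≤ Q.card + 2 → ∀ σ,
      ∑ ρ ∈ agree σ Q', f ρ ≤ K * (agree σ Q').card) :
    ∑ σ ∈ agree τ Q, (degenerates P σ).card * f σ ≤
      K * ∑ σ ∈ agree τ Q, ((degenerates P σ).card : ℝ) := by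
  rw [sum_card_degenerates, mul_sum]
  simp only [degenerates, ← sum_ite_eq_card, sum_mul, ite_mul, one_mul, zero_mul]
  rw [sum_comm]
  refine sum_le_sum fun p _ => ?_
  rw [sum_ite_eq_card]
  refine sum_degenerate_mul_le p fun σ _ => H _ ?_ _
  have := card_insert_le p.2 (insert p.1 Q)
  have := card_insert_le p.1 Q
  omega

/-- Revealing a degenerate pair destroys cleanness, so two factors cost `3 * δ * W + 14 * Δ` each,
`W` being the number of pairs. The remaining mean is taken over the clean class and costs only `3 *
δ * W`; this saving is what makes the third moment small enough when `W` is only slightly larger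
than `Δ`. -/
theorem sum_degenerates_pow_three_le (hΔ : ∀ a u, S.deg a u ≤ Δ) (hδ0 : 0 ≤ δ)
    (hδ : (Δ : ℝ) ≤ δ * (S.m - 8)) {τ : S.Matching} {Q : Finset S.HalfEdge}
    (hQ : Q.card ≤ 3) (hc : Clean τ Q) (a b : Dir) :
    ∑ σ ∈ agree τ Q, ((degenerates (S.pairs a b) σ).card : ℝ) ^ 3 ≤
      (3 * δ * (S.pairs a b).card + 14 * Δ) ^ 2 * (3 * δ * (S.pairs a b).card) *
        (agree τ Q).card := by
  set K : ℝ := 3 * δ * (S.pairs a b).card + 14 * Δ with hK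
  have hK0 : 0 ≤ K := by positivity
  have s2 : ∀ Q' : Finset S.HalfEdge, Q'.card ≤ 5 → ∀ σ,
      ∑ ρ ∈ agree σ Q', ((degenerates (S.pairs a b) ρ).card : ℝ) ^ 2 ≤
        K ^ 2 * (agree σ Q').card := by
    intro Q' hQ' σ
    simp only [pow_two]
    refine (sum_degenerates_mul_le (S.pairs a b) (K := K) fun Q'' hQ'' ρ => ?_).trans ?_
    · exact sum_degenerates_le hΔ hδ0 hδ ((card_edges_le _ _).trans (by omega)) a b
    · rw [mul_assoc]
      exact mul_le_mul_of_nonneg_left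
        (sum_degenerates_le hΔ hδ0 hδ ((card_edges_le _ _).trans (by omega)) a b) hK0
  simp only [pow_succ' _ 2]
  refine (sum_degenerates_mul_le (S.pairs a b) (K := K ^ 2) fun Q' hQ' ρ =>
    s2 Q' (by omega) ρ).trans ?_
  rw [mul_assoc (K ^ 2)]
  exact mul_le_mul_of_nonneg_left
    (sum_degenerates_le_of_clean hΔ hδ0 hδ ((card_edges_le _ _).trans (by omega)) hc a b)
    (by positivity)

end bounds

/-! ### The mean inverse of the number of wedges. -/

section inverse

/-- The difference of `1 / (W - D)` and `1 / W` is `D / (W * (W - D))`, and `W - D` is at least 1.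
-/
lemma one_div_le_first {W D : ℝ} (hW : 0 < W) (hD : 0 ≤ D) (h : 1 ≤ W - D) :
    1 / (W - D) ≤ (1 + D) / W := by
  rw [div_le_div_iff₀ (by linarith) hW]
  nlinarith

/-- The geometric expansion of `1 / (W - D)` with remainder `D ^ 3 / (W ^ 3 * (W - D))`; the
quadratic term is at most `D / W ^ 2` because `D ≤ W`. -/
lemma one_div_le_third {W D : ℝ} (hW : 0 < W) (hD : 0 ≤ D) (h : 1 ≤ W - D) :
    1 / (W - D) ≤ 1 / W + 2 * D / W ^ 2 + D ^ 3 / W ^ 3 := by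
  have hN : 0 < W - D := by linarith
  have e : 1 / W + 2 * D / W ^ 2 + D ^ 3 / W ^ 3 = (W ^ 2 + 2 * D * W + D ^ 3) / W ^ 3 := by
    field_simp
  rw [e, div_le_div_iff₀ hN (by positivity)]
  have h1 : D ^ 3 * 1 ≤ D ^ 3 * (W - D) := mul_le_mul_of_nonneg_left h (by positivity)
  have h2 : 0 ≤ D * (W - D) * (W - D) := by positivity
  nlinarith

lemma card_pairs_le {Δ : ℕ} (hΔ : ∀ a u, S.deg a u ≤ Δ) (τ : S.Matching) (a b : Dir) :
    ((S.pairs a b).card : ℝ) ≤ S.m * Δ := by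
  have := card_pairs_fst_le hΔ τ univ a b
  rw [filter_true_of_mem fun _ _ => mem_univ _, card_univ, card_stub] at this
  exact_mod_cast this

/-- If the mates of the half-edges in `Q` force at least one wedge and form no loops or double
connections, then the number of wedges has mean inverse close to the inverse of the number of pairs of half-edges. -/
theorem sum_inv_le {Δ : ℕ} {δ : ℝ} (hΔ : ∀ a u, S.deg a u ≤ Δ) (hΔ1 : 1 ≤ Δ) (hδ0 : 0 ≤ δ)
    (hδ : (Δ : ℝ) ≤ δ * (S.m - 8)) (hδ2 : δ * S.m ≤ 2 * Δ) (hδ1 : δ * Δ ≤ 1)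
    {τ : S.Matching} {Q : Finset S.HalfEdge} (hQ : Q.card ≤ 3) (hc : Clean τ Q) (a b : Dir)
    (hN : ∀ σ ∈ agree τ Q, (degenerates (S.pairs a b) σ).card < (S.pairs a b).card) :
    ∑ σ ∈ agree τ Q, 1 / (((S.pairs a b).card : ℝ) - (degenerates (S.pairs a b) σ).card) ≤
      1 / (S.pairs a b).card * (1 + 1000 * (δ * Δ)) * (agree τ Q).card := by
  set W : ℝ := ((S.pairs a b).card : ℝ) with hW
  set A : ℝ := ((agree τ Q).card : ℝ) with hA
  have hΔ1' : (1 : ℝ) ≤ Δ := by exact_mod_cast hΔ1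
  have hW1 : (1 : ℝ) ≤ W := by
    have := hN τ (self_mem_agree τ Q)
    rw [hW]
    exact_mod_cast (show 1 ≤ (S.pairs a b).card by omega)
  have hW0 : 0 < W := by linarith
  have hA0 : 0 ≤ A := by positivity
  have hN' : ∀ σ ∈ agree τ Q, 1 ≤ W - (degenerates (S.pairs a b) σ).card := by
    intro σ hσ
    have : ((degenerates (S.pairs a b) σ).card : ℝ) + 1 ≤ W := by
      rw [hW]
      exact_mod_cast hN σ hσ
    linarith
  have hD1 := sum_degenerates_le_of_clean hΔ hδ0 hδ ((card_edges_le τ Q).trans (by omega)) hc a b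
  have hD3 := sum_degenerates_pow_three_le hΔ hδ0 hδ hQ hc a b
  rw [← hW, ← hA] at hD1 hD3
  -- For `W ≤ Δ` the first-order bound has relative error `3 * δ * W`, which is small enough. For
  -- larger `W` the third-order bound is used, and its worst term carries the factor `Δ / W < 1`.
  by_cases hWΔ : W ≤ Δ
  · calc _ ≤ ∑ σ ∈ agree τ Q, (1 + ((degenerates (S.pairs a b) σ).card : ℝ)) / W :=
          sum_le_sum fun σ hσ => one_div_le_first hW0 (Nat.cast_nonneg _) (hN' σ hσ)
      _ ≤ (A + 3 * δ * W * A) / W := by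
          rw [← sum_div, sum_add_distrib, sum_const, nsmul_eq_mul, mul_one, ← hA]
          gcongr
      _ = 1 / W * (1 + 3 * (δ * W)) * A := by ring
      _ ≤ 1 / W * (1 + 1000 * (δ * Δ)) * A := by
          have : δ * W ≤ δ * Δ := by gcongr
          have : 0 ≤ δ * Δ := by positivity
          gcongr
          linarith
  · push Not at hWΔ
    calc _ ≤ ∑ σ ∈ agree τ Q, (1 / W + 2 * ((degenerates (S.pairs a b) σ).card : ℝ) / W ^ 2 +
            ((degenerates (S.pairs a b) σ).card : ℝ) ^ 3 / W ^ 3) :=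
          sum_le_sum fun σ hσ => one_div_le_third hW0 (Nat.cast_nonneg _) (hN' σ hσ)
      _ ≤ A * (1 / W) + 2 * (3 * δ * W * A) / W ^ 2 +
            (3 * δ * W + 14 * Δ) ^ 2 * (3 * δ * W) * A / W ^ 3 := by
          rw [sum_add_distrib, sum_add_distrib, sum_const, nsmul_eq_mul, ← sum_div, ← sum_div,
            ← mul_sum, ← hA]
          gcongr
      _ = 1 / W * (1 + 6 * δ + 27 * (δ ^ 2 * (δ * W)) + 252 * (δ * (δ * Δ)) +
            588 * (δ * Δ * (Δ / W))) * A := by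
          field_simp
          ring
      _ ≤ 1 / W * (1 + 1000 * (δ * Δ)) * A := by
          have h0 : 0 ≤ δ * Δ := by positivity
          have h1 : δ ≤ δ * Δ := le_mul_of_one_le_right hδ0 hΔ1'
          have h2 : δ * W ≤ 2 * (Δ * Δ) := by
            calc δ * W ≤ δ * (S.m * Δ) := by
                  gcongr
                  exact card_pairs_le hΔ τ a b
              _ = δ * S.m * Δ := by ring
              _ ≤ 2 * Δ * Δ := by gcongr
              _ = _ := by ring
          have h3 : δ ^ 2 * (δ * W) ≤ 2 * (δ * Δ) := by
            calc δ ^ 2 * (δ * W) ≤ δ ^ 2 * (2 * (Δ * Δ)) := by gcongr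
              _ = 2 * (δ * Δ) * (δ * Δ) := by ring
              _ ≤ 2 * (δ * Δ) * 1 := by gcongr
              _ = _ := by ring
          have h4 : δ * (δ * Δ) ≤ 1 * (δ * Δ) := by
            gcongr
            linarith
          have h5 : δ * Δ * (Δ / W) ≤ δ * Δ * 1 := by
            gcongr
            rw [div_le_one hW0]
            exact hWΔ.le
          refine mul_le_mul_of_nonneg_right (mul_le_mul_of_nonneg_left ?_ (by positivity)) hA0
          linarith

end inverse

/-! ### Wedges and closed wedges as pairs of half-edges. -/

section bridge

/-- A wedge corresponds to the two halves of its edges at the center. The predicate `R` lets one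
bijection serve both for all wedges and for closed ones. -/
lemma sum_card_wedges (σ : S.Matching) (x y : Dir) (R : V → S.Stub .o → Prop)
    [∀ u, DecidablePred (R u)] :
    ∑ u, (univ.filter fun p : S.Stub .o × S.Stub .o =>
        (S.graph σ).IsWedge x y u p.1 p.2 ∧ R u p.2).card =
      ((S.pairs x.opp y).filter fun p =>
        ¬ Degenerate σ p ∧ R (node (mate σ p.1)) (edge σ p.2)).card := by
  rw [card_eq_sum_card_fiberwise (f := fun p => node (mate σ p.1)) (t := univ)
    (fun _ _ => mem_univ _)]
  refine sum_congr rfl fun u _ => ?_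
  have hW : ∀ e f, (S.graph σ).IsWedge x y u e f ↔
      (half σ x.opp e, half σ y f) ∈ S.pairs x.opp y ∧
        ¬ Degenerate σ (half σ x.opp e, half σ y f) ∧ node (mate σ (half σ x.opp e)) = u := by
    intro e f
    simp only [DirMultigraph.IsWedge, endAt_graph, mem_pairs, Degenerate, mate_half, half_fst,
      Dir.opp_opp, and_true, not_or]
    constructor
    · rintro ⟨rfl, h1, h2, h3, h4⟩
      refine ⟨⟨?_, h1⟩, ⟨by rwa [h1], fun h => h3 h.symm, h4⟩, rfl⟩
      -- If the two halves at the center coincided, so would their mates, and head and tail would be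
      -- the same node.
      intro h
      apply h4
      have := congrArg (mate σ) h
      simp only [mate_half, Dir.opp_opp] at this
      rw [this]
    · rintro ⟨⟨-, h1⟩, ⟨h2, h3, h4⟩, rfl⟩
      exact ⟨rfl, h1, by rwa [← h1], fun h => h3 h.symm, h4⟩
  refine card_bij' (fun p _ => (half σ x.opp p.1, half σ y p.2))
    (fun p _ => (edge σ p.1, edge σ p.2)) ?_ ?_ ?_ ?_
  · rintro ⟨e, f⟩ h
    simp only [mem_filter, mem_univ, true_and, hW] at h ⊢
    obtain ⟨⟨h1, h2, rfl⟩, h3⟩ := h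
    exact ⟨⟨h1, h2, by simpa using h3⟩, rfl⟩
  · rintro ⟨h, g⟩ hp
    simp only [mem_filter, mem_univ, true_and, hW] at hp ⊢
    obtain ⟨⟨h1, h2, h3⟩, rfl⟩ := hp
    obtain ⟨-, -, hx, hy⟩ := mem_pairs.1 h1
    simp only at hx hy
    rw [← hx, ← hy, half_edge, half_edge, hx, hy]
    exact ⟨⟨h1, h2, rfl⟩, h3⟩
  · rintro ⟨e, f⟩ h
    simp
  · rintro ⟨h, g⟩ hp
    simp only [mem_filter, mem_pairs] at hp
    obtain ⟨⟨⟨-, -, hx, hy⟩, -⟩, -⟩ := hp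
    rw [← hx, ← hy]
    simp

lemma wedges_add_degenerates (σ : S.Matching) (x y : Dir) :
    (S.graph σ).wedges x y + (degenerates (S.pairs x.opp y) σ).card =
      (S.pairs x.opp y).card := by
  have := sum_card_wedges σ x y fun _ _ => True
  simp only [and_true] at this
  rw [DirMultigraph.wedges]
  simp only [DirMultigraph.wedgesAt]
  rw [this, degenerates, add_comm]
  exact card_filter_add_card_filter_not _

/-- The half-edges of direction `z` whose edges close the wedge at the pair `p`. -/
def closings (σ : S.Matching) (z : Dir) (p : S.HalfEdge × S.HalfEdge) : Finset S.HalfEdge :=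
  univ.filter fun c => c.1 = z ∧ node c = node (mate σ p.1) ∧
    node (mate σ c) = node (mate σ p.2)

lemma mem_closings {σ : S.Matching} {z : Dir} {p : S.HalfEdge × S.HalfEdge} {c : S.HalfEdge} :
    c ∈ closings σ z p ↔ c.1 = z ∧ node c = node (mate σ p.1) ∧
      node (mate σ c) = node (mate σ p.2) := by simp [closings]

lemma closedWedges_eq (σ : S.Matching) (x y z : Dir) :
    (S.graph σ).closedWedges x y z = ((S.pairs x.opp y).filter fun p =>
      ¬ Degenerate σ p ∧ (closings σ z p).Nonempty).card := by
  rw [DirMultigraph.closedWedges]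
  simp only [DirMultigraph.closedWedgesAt]
  rw [sum_card_wedges σ x y fun u f => (S.graph σ).IsClosedBy y z u f]
  refine congrArg _ (filter_congr fun p hp => and_congr_right fun _ => ?_)
  obtain ⟨-, -, hx, hy⟩ := mem_pairs.1 hp
  have hm : half σ y.opp (edge σ p.2) = mate σ p.2 := by
    rw [← half_edge σ (mate σ p.2), edge_mate, mate_fst, hy]
  simp only [DirMultigraph.IsClosedBy, endAt_graph, Finset.Nonempty, mem_closings, hm]
  constructor
  · rintro ⟨g, h1, h2⟩
    exact ⟨half σ z g, half_fst _ _ _, h1, by rw [mate_half, h2]⟩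
  · rintro ⟨c, rfl, h1, h2⟩
    exact ⟨edge σ c, by rw [half_edge, h1], by rw [← mate_half, half_edge, h2]⟩

end bridge

/-- With `n` elements the left side is `2 * n - n ^ 2 = 1 - (n - 1) ^ 2`. This is the pointwise form
of Bonferroni's inequality. -/
lemma card_sub_card_offDiag_le {α : Type*} [DecidableEq α] (s : Finset α) :
    (s.card : ℝ) - s.offDiag.card ≤ if s.Nonempty then 1 else 0 := by
  rcases s.eq_empty_or_nonempty with rfl | hs
  · simp
  · rw [if_pos hs, offDiag_card, Nat.cast_sub (Nat.le_mul_self _)]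
    push_cast
    have : (s.card : ℝ) ≤ 1 ∨ (2 : ℝ) ≤ s.card := by
      rcases Nat.lt_or_ge s.card 2 with h | h
      · left; exact_mod_cast (by omega)
      · right; exact_mod_cast h
    nlinarith [sq_nonneg ((s.card : ℝ) - 1)]

/-! ### Possible closed wedges and the matchings that contain them. -/

/-- A possible closed wedge: a pair of half-edges at the center, a pair at the head and a pair
at the tail. -/
abbrev Triangle (S : JointDegSeq V) : Type _ :=
  (S.HalfEdge × S.HalfEdge) × (S.HalfEdge × S.HalfEdge) × (S.HalfEdge × S.HalfEdge)

/-- The possible `z`-closed wedges of type `xy`. -/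
def triangles (S : JointDegSeq V) (x y z : Dir) : Finset S.Triangle :=
  (S.pairs x.opp y ×ˢ S.pairs x z ×ˢ S.pairs y.opp z.opp).filter fun t =>
    node t.2.1.1 ≠ node t.1.1 ∧ node t.2.2.1 ≠ node t.1.1 ∧ node t.2.1.1 ≠ node t.2.2.1

/-- The matchings that contain the three edges of a possible closed wedge. -/
def containing (t : S.Triangle) : Finset S.Matching :=
  univ.filter fun σ => mate σ t.1.1 = t.2.1.1 ∧ mate σ t.1.2 = t.2.2.1 ∧
    mate σ t.2.1.2 = t.2.2.2

lemma mem_containing {t : S.Triangle} {σ : S.Matching} :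
    σ ∈ containing t ↔ mate σ t.1.1 = t.2.1.1 ∧ mate σ t.1.2 = t.2.2.1 ∧
      mate σ t.2.1.2 = t.2.2.2 := by simp [containing]

lemma mem_triangles {x y z : Dir} {t : S.Triangle} :
    t ∈ S.triangles x y z ↔ (t.1 ∈ S.pairs x.opp y ∧ t.2.1 ∈ S.pairs x z ∧
      t.2.2 ∈ S.pairs y.opp z.opp) ∧
      node t.2.1.1 ≠ node t.1.1 ∧ node t.2.2.1 ≠ node t.1.1 ∧ node t.2.1.1 ≠ node t.2.2.1 := by
  simp [triangles]

/-- Half-edges that determine the edges of a possible closed wedge. -/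
def corners (t : S.Triangle) : Finset S.HalfEdge := {t.1.1, t.1.2, t.2.1.2}

lemma containing_eq_agree {t : S.Triangle} {τ : S.Matching} (hτ : τ ∈ containing t) :
    containing t = agree τ (corners t) := by
  obtain ⟨h1, h2, h3⟩ := mem_containing.1 hτ
  ext σ
  simp [mem_containing, corners, h1, h2, h3]

lemma edge_mem_edges_corners {t : S.Triangle} {τ : S.Matching} (hτ : τ ∈ containing t)
    {h : S.HalfEdge} (hh : edge τ h ∈ edges τ (corners t)) :
    (h = t.1.1 ∨ h = t.1.2 ∨ h = t.2.1.1 ∨ h = t.2.1.2 ∨ h = t.2.2.1 ∨ h = t.2.2.2) := by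
  obtain ⟨h1, h2, h3⟩ := mem_containing.1 hτ
  simp only [edges, corners, image_insert, image_singleton, mem_insert, mem_singleton,
    edge_eq_iff, h1, h2, h3] at hh
  tauto

/-- The three edges join three different nodes, one edge for each two of them, so they form neither
a loop nor a double connection. -/
lemma clean_corners {x y z : Dir} {t : S.Triangle} (ht : t ∈ S.triangles x y z) {τ : S.Matching}
    (hτ : τ ∈ containing t) : Clean τ (corners t) := by
  obtain ⟨⟨h1, h2, h3⟩, n1, n2, n3⟩ := mem_triangles.1 ht
  obtain ⟨p1, q1, -, -⟩ := mem_pairs.1 h1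
  obtain ⟨p2, q2, -, -⟩ := mem_pairs.1 h2
  obtain ⟨p3, q3, -, -⟩ := mem_pairs.1 h3
  obtain ⟨m1, m2, m3⟩ := mem_containing.1 hτ
  have m1' : mate τ t.2.1.1 = t.1.1 := by rw [← m1, mate_mate]
  have m2' : mate τ t.2.2.1 = t.1.2 := by rw [← m2, mate_mate]
  have m3' : mate τ t.2.2.2 = t.2.1.2 := by rw [← m3, mate_mate]
  obtain ⟨⟨a1, a2⟩, ⟨b1, b2⟩, ⟨c1, c2⟩⟩ := t
  simp only at *
  constructor
  · intro h hh
    rcases edge_mem_edges_corners hτ hh with rfl | rfl | rfl | rfl | rfl | rfl <;>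
      simp only [m1, m2, m3, m1', m2', m3'] <;> grind
  · intro h g hh hg
    rcases edge_mem_edges_corners hτ hh with rfl | rfl | rfl | rfl | rfl | rfl <;>
      rcases edge_mem_edges_corners hτ hg with rfl | rfl | rfl | rfl | rfl | rfl <;>
      simp only [m1, m2, m3, m1', m2', m3'] <;> grind

/-- Precomposing `τ` with the transposition of the edges of `h` and `k` joins them and leaves the
edges of `Q` alone. -/
lemma exists_matching_insert {τ : S.Matching} {Q : Finset S.HalfEdge} {h k : S.HalfEdge}
    (hd : k.1 = h.1.opp) (hh : edge τ h ∉ edges τ Q) (hk : edge τ k ∉ edges τ Q) :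
    ∃ σ ∈ agree τ Q, mate σ h = k := by
  have key : ∀ (e : S.Stub .o) (g : S.Stub .i), e ∉ edges τ Q → τ.symm g ∉ edges τ Q →
      ∃ σ ∈ agree τ Q, σ e = g := by
    intro e g he hg
    refine ⟨(Equiv.swap e (τ.symm g)).trans τ, mem_agree.2 fun q hq => ?_, by simp⟩
    have hq' : edge τ q ∈ edges τ Q := mem_image_of_mem _ hq
    rw [mate_eq_mate_iff, Equiv.trans_apply, Equiv.swap_apply_of_ne_of_ne]
    · rintro rfl; exact he hq'
    · rintro h; exact hg (h ▸ hq')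
  rcases h with ⟨_ | _, s⟩ <;> rcases k with ⟨_ | _, r⟩ <;> simp [Dir.opp] at hd
  · obtain ⟨σ, h1, h2⟩ := key r s hk hh
    exact ⟨σ, h1, by simp [mate, ← h2]⟩
  · obtain ⟨σ, h1, h2⟩ := key s r hh hk
    exact ⟨σ, h1, by simp [mate, h2]⟩

lemma containing_nonempty {x y z : Dir} {t : S.Triangle} (ht : t ∈ S.triangles x y z)
    (τ : S.Matching) : (containing t).Nonempty := by
  obtain ⟨⟨h1, h2, h3⟩, n1, n2, n3⟩ := mem_triangles.1 ht
  obtain ⟨p1, q1, d1, e1⟩ := mem_pairs.1 h1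
  obtain ⟨p2, q2, d2, e2⟩ := mem_pairs.1 h2
  obtain ⟨p3, q3, d3, e3⟩ := mem_pairs.1 h3
  obtain ⟨⟨a1, a2⟩, ⟨b1, b2⟩, ⟨c1, c2⟩⟩ := t
  simp only at *
  obtain ⟨σ, -, s1⟩ := exists_matching_insert (τ := τ) (Q := ∅) (h := a1) (k := b1)
    (by rw [d1, d2, Dir.opp_opp]) (by simp [edges]) (by simp [edges])
  have s1' : mate σ b1 = a1 := by rw [← s1, mate_mate]
  obtain ⟨ρ, r, r2⟩ := exists_matching_insert (τ := σ) (Q := {a1}) (h := a2) (k := c1)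
    (by rw [d3, e1])
    (by simp only [edges, image_singleton, mem_singleton, edge_eq_iff, s1]; grind)
    (by simp only [edges, image_singleton, mem_singleton, edge_eq_iff, s1]; grind)
  have r1 : mate ρ a1 = b1 := by rw [mem_agree.1 r a1 (mem_singleton_self _), s1]
  obtain ⟨π, w, w3⟩ := exists_matching_insert (τ := ρ) (Q := {a1, a2}) (h := b2) (k := c2)
    (by rw [e3, e2])
    (by simp only [edges, image_insert, image_singleton, mem_insert, mem_singleton, edge_eq_iff,
          r1, r2]; grind)
    (by simp only [edges, image_insert, image_singleton, mem_insert, mem_singleton, edge_eq_iff,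
          r1, r2]; grind)
  refine ⟨π, mem_containing.2 ⟨?_, ?_, w3⟩⟩
  · rw [mem_agree.1 w a1 (by simp), r1]
  · rw [mem_agree.1 w a2 (by simp), r2]

lemma card_edges_corners {x y z : Dir} {t : S.Triangle} (ht : t ∈ S.triangles x y z)
    {τ : S.Matching} (hτ : τ ∈ containing t) : (edges τ (corners t)).card = 3 := by
  obtain ⟨⟨h1, h2, h3⟩, n1, n2, n3⟩ := mem_triangles.1 ht
  obtain ⟨p1, q1, -, -⟩ := mem_pairs.1 h1
  obtain ⟨p2, q2, -, -⟩ := mem_pairs.1 h2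
  obtain ⟨p3, q3, -, -⟩ := mem_pairs.1 h3
  obtain ⟨m1, m2, m3⟩ := mem_containing.1 hτ
  obtain ⟨⟨a1, a2⟩, ⟨b1, b2⟩, ⟨c1, c2⟩⟩ := t
  simp only at *
  rw [edges, corners, image_insert, image_insert, image_singleton]
  refine card_eq_three.2 ⟨_, _, _, ?_, ?_, ?_, rfl⟩
  · rw [ne_comm, Ne, edge_eq_iff, m1]; grind
  · rw [ne_comm, Ne, edge_eq_iff, m1]; grind
  · rw [ne_comm, Ne, edge_eq_iff, m2]; grind

lemma card_containing {x y z : Dir} {t : S.Triangle} (ht : t ∈ S.triangles x y z)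
    (τ : S.Matching) : (containing t).card = (S.m - 3).factorial := by
  obtain ⟨σ, hσ⟩ := containing_nonempty ht τ
  rw [containing_eq_agree hσ, card_agree, card_edges_corners ht hσ]

/-- The matchings that contain a possible closed wedge and a further given edge. -/
lemma card_containing_mate_le {x y z : Dir} {t : S.Triangle} (ht : t ∈ S.triangles x y z)
    {c d : S.HalfEdge} (hc : c ≠ t.2.1.2) (hc1 : node c = node t.2.1.1)
    (hd : node d = node t.2.2.1) :
    ((containing t).filter fun σ => mate σ c = d).card ≤ (S.m - 4).factorial := by
  rcases ((containing t).filter fun σ => mate σ c = d).eq_empty_or_nonempty with h0 | ⟨σ, hσ⟩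
  · rw [h0]; simp
  · obtain ⟨h1, rfl⟩ := mem_filter.1 hσ
    -- The only half-edges of the triangle at the head are `t.2.1.2`, which is excluded, and
    -- `t.2.1.1`, whose mate lies at the center and not at the tail.
    have h2 : edge σ c ∉ edges σ (corners t) := by
      intro hh
      obtain ⟨⟨h1', h2', h3'⟩, n1, n2, n3⟩ := mem_triangles.1 ht
      obtain ⟨p1, q1, -, -⟩ := mem_pairs.1 h1'
      obtain ⟨p2, q2, -, -⟩ := mem_pairs.1 h2'
      obtain ⟨p3, q3, -, -⟩ := mem_pairs.1 h3'
      obtain ⟨m1, m2, m3⟩ := mem_containing.1 h1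
      have m1' : mate σ t.2.1.1 = t.1.1 := by rw [← m1, mate_mate]
      rcases edge_mem_edges_corners h1 hh with rfl | rfl | rfl | rfl | rfl | rfl <;> grind
    rw [containing_eq_agree h1, ← agree_insert_eq c (self_mem_agree _ _), card_agree,
      card_edges_insert h2, card_edges_corners ht h1]

/-! ### Comparing closed wedges with triangles. -/

section counting

/-- A choice of closing half-edge turns a closed wedge into a triangle, from which the wedge is
recovered as the first component. -/
lemma closedWedges_le (σ : S.Matching) (x y z : Dir) :
    (S.graph σ).closedWedges x y z ≤
      ((S.triangles x y z).filter fun t => σ ∈ containing t).card := by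
  rw [closedWedges_eq]
  refine (card_le_card ?_).trans (card_image_le (f := fun t : S.Triangle => t.1))
  intro p hp
  obtain ⟨h1, h2, c, hc⟩ := by simpa only [mem_filter] using hp
  obtain ⟨hc1, hc2, hc3⟩ := mem_closings.1 hc
  obtain ⟨p1, p2, p3, p4⟩ := mem_pairs.1 h1
  simp only [Degenerate, not_or] at h2
  refine mem_image.2 ⟨(p, (mate σ p.1, c), (mate σ p.2, mate σ c)), ?_, rfl⟩
  rw [mem_filter, mem_triangles, mem_containing]
  refine ⟨⟨⟨h1, ?_, ?_⟩, h2.1, ?_, h2.2.2⟩, rfl, rfl, rfl⟩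
  · refine mem_pairs.2 ⟨?_, hc2.symm, by simp [p3], hc1⟩
    -- A closing half-edge equal to the mate of `p.1` would put the tail at the center.
    rintro h
    simp only at h
    rw [← h, mate_mate] at hc3
    exact h2.2.1 (by rw [← hc3, p2])
  · refine mem_pairs.2 ⟨?_, hc3.symm, by simp [p4], by simp [hc1]⟩
    intro h
    simp only at h
    have := congrArg (mate σ) h
    rw [mate_mate, mate_mate] at this
    rw [← this] at hc2
    exact h2.1 (by rw [← hc2, ← p2])
  · simpa [p2] using h2.2.1

lemma card_triangles_le (x y z : Dir) :
    ((S.triangles x y z).card : ℝ) ≤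
      (S.pairs x.opp y).card * (S.pairs x z).card * (S.pairs y.opp z.opp).card := by
  refine (Nat.cast_le.2 (card_filter_le _ _)).trans (le_of_eq ?_)
  rw [card_product, card_product]
  push_cast
  ring

/-- Further half-edges, with their possible mates, that may close the wedge a second time. -/
def reclosings (t : S.Triangle) (z : Dir) : Finset (S.HalfEdge × S.HalfEdge) :=
  (S.star z (node t.2.1.1) ×ˢ S.star z.opp (node t.2.2.1)).filter fun c => c.1 ≠ t.2.1.2

lemma card_reclosings_le {Δ : ℕ} (hΔ : ∀ a u, S.deg a u ≤ Δ) (t : S.Triangle) (z : Dir) :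
    (reclosings t z).card ≤ Δ ^ 2 := by
  refine (card_filter_le _ _).trans ?_
  rw [card_product, card_star, card_star, pow_two]
  exact Nat.mul_le_mul (hΔ _ _) (hΔ _ _)

/-- Bonferroni's inequality for the number of closed wedges. -/
lemma le_closedWedges (σ : S.Matching) (x y z : Dir) :
    (((S.triangles x y z).filter fun t => σ ∈ containing t).card : ℝ) -
      ∑ t ∈ (S.triangles x y z).filter (fun t => σ ∈ containing t),
        (((reclosings t z).filter fun c => mate σ c.1 = c.2).card : ℝ) ≤
      (S.graph σ).closedWedges x y z := by
  set G := (S.pairs x.opp y).filter fun p => ¬ Degenerate σ p with hG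
  set T := (S.triangles x y z).filter fun t => σ ∈ containing t with hT
  have hTG : ∀ t ∈ T, t.1 ∈ G ∧ t.2.1.2 ∈ closings σ z t.1 := by
    intro t ht
    obtain ⟨h1, h2⟩ := mem_filter.1 ht
    obtain ⟨⟨g1, g2, g3⟩, n1, n2, n3⟩ := mem_triangles.1 h1
    obtain ⟨p1, q1, -, -⟩ := mem_pairs.1 g1
    obtain ⟨p2, q2, -, e2⟩ := mem_pairs.1 g2
    obtain ⟨p3, q3, -, -⟩ := mem_pairs.1 g3
    obtain ⟨m1, m2, m3⟩ := mem_containing.1 h2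
    refine ⟨mem_filter.2 ⟨g1, ?_⟩, mem_closings.2 ⟨e2, ?_, ?_⟩⟩
    · simp only [Degenerate, m1, m2, not_or]
      exact ⟨n1, by rwa [← q1], n3⟩
    · rw [m1, q2]
    · rw [m2, m3, q3]
  have hGT : ∀ p ∈ G, ∀ c ∈ closings σ z p,
      (p, (mate σ p.1, c), (mate σ p.2, mate σ c)) ∈ T := by
    intro p hp c hc
    obtain ⟨h1, h2⟩ := mem_filter.1 hp
    obtain ⟨hc1, hc2, hc3⟩ := mem_closings.1 hc
    obtain ⟨p1, p2, p3, p4⟩ := mem_pairs.1 h1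
    simp only [Degenerate, not_or] at h2
    rw [hT, mem_filter, mem_triangles, mem_containing]
    refine ⟨⟨⟨h1, ?_, ?_⟩, h2.1, ?_, h2.2.2⟩, rfl, rfl, rfl⟩
    · refine mem_pairs.2 ⟨?_, hc2.symm, by simp [p3], hc1⟩
      rintro h
      simp only at h
      rw [← h, mate_mate] at hc3
      exact h2.2.1 (by rw [← hc3, p2])
    · refine mem_pairs.2 ⟨?_, hc3.symm, by simp [p4], by simp [hc1]⟩
      intro h
      simp only at h
      have := congrArg (mate σ) h
      rw [mate_mate, mate_mate] at this
      rw [← this] at hc2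
      exact h2.1 (by rw [← hc2, ← p2])
    · simpa [p2] using h2.2.1
  -- In a fixed matching, a triangle is a wedge together with one of its closing half-edges.
  have e1 : T.card = ∑ p ∈ G, (closings σ z p).card := by
    rw [← card_sigma]
    refine card_bij' (fun t _ => ⟨t.1, t.2.1.2⟩)
      (fun s _ => (s.1, (mate σ s.1.1, s.2), (mate σ s.1.2, mate σ s.2))) ?_ ?_ ?_ ?_
    · intro t ht
      simpa using hTG t ht
    · rintro ⟨p, c⟩ h
      obtain ⟨h1, h2⟩ := mem_sigma.1 h
      exact hGT p h1 c h2
    · intro t ht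
      obtain ⟨m1, m2, m3⟩ := mem_containing.1 (mem_filter.1 ht).2
      simp only [m1, m2, m3]
    · rintro ⟨p, c⟩ h
      rfl
  -- Of two different closings of a wedge, the first gives a triangle and the second a reclosing of
  -- it.
  have e2 : ∑ p ∈ G, (closings σ z p).offDiag.card ≤
      ∑ t ∈ T, ((reclosings t z).filter fun c => mate σ c.1 = c.2).card := by
    rw [← card_sigma, ← card_sigma]
    refine card_le_card_of_injOn (fun s => ⟨(s.1, (mate σ s.1.1, s.2.1),
      (mate σ s.1.2, mate σ s.2.1)), (s.2.2, mate σ s.2.2)⟩) ?_ ?_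
    · rintro ⟨p, c, c'⟩ h
      obtain ⟨h1, h2⟩ := mem_sigma.1 (mem_coe.1 h)
      obtain ⟨h3, h4, h5⟩ := mem_offDiag.1 h2
      obtain ⟨h6, h7, h8⟩ := mem_closings.1 h4
      refine mem_coe.2 (mem_sigma.2 ⟨hGT p h1 c h3, mem_filter.2 ⟨?_, rfl⟩⟩)
      simp only [reclosings, mem_filter, mem_product, mem_star, mate_fst]
      exact ⟨⟨⟨h6, h7⟩, by rw [h6], h8⟩, h5.symm⟩
    · rintro ⟨p, c, c'⟩ - ⟨q, d, d'⟩ - h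
      simp only [Sigma.mk.injEq, Prod.mk.injEq, heq_eq_eq] at h ⊢
      tauto
  have e3 : ((S.graph σ).closedWedges x y z : ℝ) =
      ∑ p ∈ G, if (closings σ z p).Nonempty then 1 else 0 := by
    rw [closedWedges_eq, sum_ite_eq_card, hG, filter_filter]
  rw [e3]
  refine le_trans ?_ (sum_le_sum fun p _ => card_sub_card_offDiag_le (closings σ z p))
  rw [sum_sub_distrib, e1]
  have e2' : ∑ p ∈ G, ((closings σ z p).offDiag.card : ℝ) ≤
      ∑ t ∈ T, (((reclosings t z).filter fun c => mate σ c.1 = c.2).card : ℝ) := by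
    exact_mod_cast e2
  push_cast
  linarith

/-- If no node dominates the pairs of half-edges at heads and at tails, then almost all triples of
pairs have three different nodes. -/
lemma le_card_triangles (x y z : Dir) {ε : ℝ}
    (h1 : ∀ u, S.stubPairs x z u ≤ ε * (S.pairs x z).card)
    (h2 : ∀ u, S.stubPairs y.opp z.opp u ≤ ε * (S.pairs y.opp z.opp).card) :
    (1 - 3 * ε) *
      ((S.pairs x.opp y).card * (S.pairs x z).card * (S.pairs y.opp z.opp).card) ≤
      (S.triangles x y z).card := by
  set P := S.pairs x.opp y
  set A := S.pairs x z with hA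
  set B := S.pairs y.opp z.opp with hB
  have hAv : ∀ v, ((A.filter fun q => node q.1 = v).card : ℝ) ≤ ε * A.card := by
    intro v
    refine le_trans (le_of_eq ?_) (h1 v)
    rw [← card_pairsAt]
    congr 2
    ext q
    simp [mem_pairsAt, hA]
  have hBv : ∀ v, ((B.filter fun q => node q.1 = v).card : ℝ) ≤ ε * B.card := by
    intro v
    refine le_trans (le_of_eq ?_) (h2 v)
    rw [← card_pairsAt]
    congr 2
    ext q
    simp [mem_pairsAt, hB]
  have hT : ((S.triangles x y z).card : ℝ) = ∑ p ∈ P, ∑ q ∈ A, ∑ r ∈ B,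
      if node q.1 ≠ node p.1 ∧ node r.1 ≠ node p.1 ∧ node q.1 ≠ node r.1 then (1 : ℝ) else 0 := by
    rw [triangles, ← sum_ite_eq_card, sum_product]
    refine sum_congr rfl fun p _ => ?_
    rw [sum_product]
  -- Union bound over the three possible coincidences of nodes; each costs a fraction `ε` of the
  -- triples.
  have hpt : ∀ p ∈ P, ∀ q ∈ A, ∀ r ∈ B,
      1 - (if node q.1 = node p.1 then (1 : ℝ) else 0) - (if node r.1 = node p.1 then 1 else 0) -
        (if node r.1 = node q.1 then 1 else 0) ≤
      if node q.1 ≠ node p.1 ∧ node r.1 ≠ node p.1 ∧ node q.1 ≠ node r.1 then (1 : ℝ) else 0 := by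
    intro p _ q _ r _
    by_cases a : node q.1 = node p.1 <;> by_cases b : node r.1 = node p.1 <;>
      by_cases c : node r.1 = node q.1 <;> simp [a, b, c] <;> grind
  rw [hT]
  refine le_trans ?_ (sum_le_sum fun p hp => sum_le_sum fun q hq => sum_le_sum fun r hr =>
    hpt p hp q hq r hr)
  have hin : ∀ p ∈ P, (1 - 3 * ε) * (A.card * B.card) ≤ ∑ q ∈ A, ∑ r ∈ B,
      (1 - (if node q.1 = node p.1 then (1 : ℝ) else 0) - (if node r.1 = node p.1 then 1 else 0) -
        (if node r.1 = node q.1 then 1 else 0)) := by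
    intro p _
    have hq : ∀ q ∈ A, ((1 - 2 * ε) - (if node q.1 = node p.1 then (1 : ℝ) else 0)) * B.card ≤
        ∑ r ∈ B, (1 - (if node q.1 = node p.1 then (1 : ℝ) else 0) -
          (if node r.1 = node p.1 then 1 else 0) - (if node r.1 = node q.1 then 1 else 0)) := by
      intro q _
      rw [sum_sub_distrib, sum_sub_distrib, sum_const, nsmul_eq_mul, sum_ite_eq_card,
        sum_ite_eq_card]
      have := hBv (node p.1)
      have := hBv (node q.1)
      linarith
    refine le_trans ?_ (sum_le_sum hq)
    rw [← sum_mul, sum_sub_distrib, sum_const, nsmul_eq_mul, sum_ite_eq_card, ← mul_assoc]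
    refine mul_le_mul_of_nonneg_right ?_ (Nat.cast_nonneg _)
    have := hAv (node p.1)
    linarith
  refine le_trans (le_of_eq ?_) (sum_le_sum hin)
  rw [sum_const, nsmul_eq_mul]
  ring

end counting

/-! ### Bounds for the two expectations. -/

lemma expectation_eq (S : JointDegSeq V) (f : DirMultigraph V (S.Stub .o) → ℝ) :
    S.expectation f = (∑ σ : S.Matching, f (S.graph σ)) / (S.m.factorial : ℝ) := by
  obtain ⟨τ⟩ := nonempty_matching S
  rw [expectation, Fintype.expect_eq_sum_div_card, card_matching τ]

lemma wedges_eq (σ : S.Matching) (x y : Dir) :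
    ((S.graph σ).wedges x y : ℝ) =
      (S.pairs x.opp y).card - (degenerates (S.pairs x.opp y) σ).card := by
  rw [← wedges_add_degenerates σ x y]
  push_cast
  ring

lemma clean_empty (τ : S.Matching) : Clean τ ∅ := by
  constructor <;> simp [edges]

lemma card_degenerates_lt_of_mem_triangles {x y z : Dir} {t : S.Triangle}
    (ht : t ∈ S.triangles x y z) {σ : S.Matching} (hσ : σ ∈ containing t) :
    (degenerates (S.pairs x.opp y) σ).card < (S.pairs x.opp y).card := by
  obtain ⟨⟨g1, g2, g3⟩, n1, n2, n3⟩ := mem_triangles.1 ht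
  obtain ⟨p1, q1, -, -⟩ := mem_pairs.1 g1
  obtain ⟨m1, m2, m3⟩ := mem_containing.1 hσ
  refine card_lt_card (filter_ssubset.2 ⟨t.1, g1, ?_⟩)
  simp only [Degenerate, m1, m2, not_or]
  exact ⟨n1, by rwa [← q1], n3⟩

section bounds

variable {Δ : ℕ} {δ : ℝ}

/-- A wedge exists with high probability. -/
theorem one_sub_le_expectation_wedges (hΔ : ∀ a u, S.deg a u ≤ Δ) (hδ0 : 0 ≤ δ)
    (hδ : (Δ : ℝ) ≤ δ * (S.m - 8)) (x y : Dir) (hW : 0 < (S.pairs x.opp y).card) :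
    1 - 3 * δ ≤ S.expectation fun G => if 0 < G.wedges x y then 1 else 0 := by
  obtain ⟨τ⟩ := nonempty_matching S
  have hW' : (0 : ℝ) < (S.pairs x.opp y).card := by exact_mod_cast hW
  have hf : (0 : ℝ) < S.m.factorial := by exact_mod_cast S.m.factorial_pos
  rw [expectation_eq, le_div_iff₀ hf]
  have h1 := sum_degenerates_le_of_clean hΔ hδ0 hδ (by simp [edges]) (clean_empty τ) x.opp y
  rw [agree_empty, card_univ, card_matching τ] at h1
  -- Markov's inequality: without a wedge every pair is degenerate, and the left side vanishes.
  have h2 : ∀ σ : S.Matching,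
      1 - ((degenerates (S.pairs x.opp y) σ).card : ℝ) / (S.pairs x.opp y).card ≤
      if 0 < (S.graph σ).wedges x y then 1 else 0 := by
    intro σ
    split_ifs with h
    · have : (0 : ℝ) ≤ (degenerates (S.pairs x.opp y) σ).card / (S.pairs x.opp y).card := by
        positivity
      linarith
    · have h3 := wedges_add_degenerates σ x y
      rw [Nat.eq_zero_of_not_pos h, zero_add] at h3
      rw [h3, div_self hW'.ne', sub_self]
  refine le_trans ?_ (sum_le_sum fun σ _ => h2 σ)
  rw [sum_sub_distrib, sum_const, nsmul_eq_mul, card_univ, card_matching τ, ← sum_div, mul_one]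
  have h4 : (∑ σ : S.Matching, ((degenerates (S.pairs x.opp y) σ).card : ℝ)) /
      (S.pairs x.opp y).card ≤ 3 * δ * S.m.factorial := by
    rw [div_le_iff₀ hW']
    linarith
  linarith

lemma expectation_wedges_le_one (S : JointDegSeq V) (x y : Dir) :
    S.expectation (fun G => if 0 < G.wedges x y then 1 else 0) ≤ 1 := by
  obtain ⟨τ⟩ := nonempty_matching S
  have hf : (0 : ℝ) < S.m.factorial := by exact_mod_cast S.m.factorial_pos
  rw [expectation_eq, div_le_one hf]
  calc _ ≤ ∑ σ : S.Matching, (1 : ℝ) := sum_le_sum fun σ _ => by split_ifs <;> norm_num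
    _ = _ := by rw [sum_const, nsmul_eq_mul, card_univ, card_matching τ, mul_one]

/-- The closed wedges are bounded by a sum over triangles. For each triangle the inverse number of
wedges is summed over the matchings that contain it, and the factor `1 / W` cancels the choice of
the center pair. -/
theorem expectation_globalClosure_le (hΔ : ∀ a u, S.deg a u ≤ Δ) (hΔ1 : 1 ≤ Δ) (hδ0 : 0 ≤ δ)
    (hδ : (Δ : ℝ) ≤ δ * (S.m - 8)) (hδ2 : δ * S.m ≤ 2 * Δ) (hδ1 : δ * Δ ≤ 1) (x y z : Dir)
    (hW : 0 < (S.pairs x.opp y).card) :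
    S.expectation (fun G => G.globalClosure x y z) ≤
      (S.pairs x z).card * (S.pairs y.opp z.opp).card * (1 + 1000 * (δ * Δ)) *
        ((S.m - 3).factorial / S.m.factorial) := by
  obtain ⟨τ⟩ := nonempty_matching S
  have hW' : (0 : ℝ) < (S.pairs x.opp y).card := by exact_mod_cast hW
  have h1 : ∀ σ : S.Matching, (S.graph σ).globalClosure x y z ≤
      ∑ t ∈ S.triangles x y z, if σ ∈ containing t then
        1 / (((S.pairs x.opp y).card : ℝ) - (degenerates (S.pairs x.opp y) σ).card) else 0 := by
    intro σ
    rw [DirMultigraph.globalClosure, wedges_eq, ← sum_filter, sum_const, nsmul_eq_mul,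
      mul_one_div]
    refine div_le_div_of_nonneg_right (Nat.cast_le.2 (closedWedges_le σ x y z)) ?_
    rw [← wedges_eq]
    positivity
  have h2 : ∀ t ∈ S.triangles x y z, (∑ σ : S.Matching, if σ ∈ containing t then
        1 / (((S.pairs x.opp y).card : ℝ) - (degenerates (S.pairs x.opp y) σ).card) else 0) ≤
      1 / (S.pairs x.opp y).card * (1 + 1000 * (δ * Δ)) * (S.m - 3).factorial := by
    intro t ht
    obtain ⟨ρ, hρ⟩ := containing_nonempty ht τ
    rw [← sum_filter, filter_mem_eq_inter, univ_inter, ← card_containing ht τ,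
      containing_eq_agree hρ]
    refine sum_inv_le hΔ hΔ1 hδ0 hδ hδ2 hδ1 card_le_three (clean_corners ht hρ) _ _ fun σ hσ => ?_
    exact card_degenerates_lt_of_mem_triangles ht ((containing_eq_agree hρ).symm ▸ hσ)
  rw [expectation_eq, mul_div_assoc']
  refine div_le_div_of_nonneg_right ?_ (by positivity)
  calc _ ≤ ∑ σ : S.Matching, ∑ t ∈ S.triangles x y z, (if σ ∈ containing t then
        1 / (((S.pairs x.opp y).card : ℝ) - (degenerates (S.pairs x.opp y) σ).card) else 0) :=
        sum_le_sum fun σ _ => h1 σ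
    _ = ∑ t ∈ S.triangles x y z, ∑ σ : S.Matching, (if σ ∈ containing t then
        1 / (((S.pairs x.opp y).card : ℝ) - (degenerates (S.pairs x.opp y) σ).card) else 0) :=
        sum_comm
    _ ≤ ∑ t ∈ S.triangles x y z,
        1 / (S.pairs x.opp y).card * (1 + 1000 * (δ * Δ)) * (S.m - 3).factorial := sum_le_sum h2
    _ = (S.triangles x y z).card *
        (1 / (S.pairs x.opp y).card * (1 + 1000 * (δ * Δ)) * (S.m - 3).factorial) := by
        rw [sum_const, nsmul_eq_mul]
    _ ≤ ((S.pairs x.opp y).card * (S.pairs x z).card * (S.pairs y.opp z.opp).card) *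
        (1 / (S.pairs x.opp y).card * (1 + 1000 * (δ * Δ)) * (S.m - 3).factorial) :=
        mul_le_mul_of_nonneg_right (card_triangles_le x y z) (by positivity)
    _ = _ := by
        field_simp

/-- Covers the case of a vanishing main term, where a relative error is determined by no quotient.
-/
lemma expectation_globalClosure_eq_zero (x y z : Dir)
    (h : (S.pairs x z).card = 0 ∨ (S.pairs y.opp z.opp).card = 0) :
    S.expectation (fun G => G.globalClosure x y z) = 0 := by
  have hT : (S.triangles x y z).card = 0 := by
    have := card_triangles_le (S := S) x y z
    rcases h with h | h <;> rw [h] at this <;> simpa using this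
  rw [expectation_eq, sum_eq_zero, zero_div]
  intro σ _
  have h1 := (closedWedges_le σ x y z).trans (card_filter_le _ _)
  rw [hT, Nat.le_zero] at h1
  rw [DirMultigraph.globalClosure, h1, Nat.cast_zero, zero_div]

/-- Replacing the number of wedges by the larger number of center pairs lowers the coefficient. A
second closing has at most `Δ ^ 2` choices and fixes a fourth edge, so it costs a fraction `Δ ^ 2 /
(m - 3) ≤ δ * Δ`. -/
theorem le_expectation_globalClosure (hΔ : ∀ a u, S.deg a u ≤ Δ) (hδ0 : 0 ≤ δ)
    (hδ : (Δ : ℝ) ≤ δ * (S.m - 8)) (hδ1 : δ * Δ ≤ 1) (hm : 4 ≤ S.m) (x y z : Dir)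
    (hW : 0 < (S.pairs x.opp y).card) {ε : ℝ}
    (h1 : ∀ u, S.stubPairs x z u ≤ ε * (S.pairs x z).card)
    (h2 : ∀ u, S.stubPairs y.opp z.opp u ≤ ε * (S.pairs y.opp z.opp).card) :
    (1 - 3 * ε) * (1 - δ * Δ) * ((S.pairs x z).card * (S.pairs y.opp z.opp).card) *
        ((S.m - 3).factorial / S.m.factorial) ≤
      S.expectation (fun G => G.globalClosure x y z) := by
  obtain ⟨τ⟩ := nonempty_matching S
  have hW' : (0 : ℝ) < (S.pairs x.opp y).card := by exact_mod_cast hW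
  set T := S.triangles x y z with hT
  have hpt : ∀ σ : S.Matching,
      ((S.graph σ).closedWedges x y z : ℝ) / (S.pairs x.opp y).card ≤
        (S.graph σ).globalClosure x y z := by
    intro σ
    rw [DirMultigraph.globalClosure]
    have hadd := wedges_add_degenerates σ x y
    rcases Nat.eq_zero_or_pos ((S.graph σ).wedges x y) with h | h
    · have : (S.graph σ).closedWedges x y z ≤ (S.graph σ).wedges x y := by
        refine sum_le_sum fun u _ => card_le_card fun p hp => ?_
        rw [mem_filter] at hp ⊢
        exact ⟨hp.1, hp.2.1⟩
      rw [h, Nat.le_zero] at this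
      simp [this]
    · refine div_le_div_of_nonneg_left (Nat.cast_nonneg _) (Nat.cast_pos.2 h) (Nat.cast_le.2 ?_)
      omega
  have hsum : (T.card : ℝ) * (S.m - 3).factorial - T.card * (Δ ^ 2 * (S.m - 4).factorial) ≤
      ∑ σ : S.Matching, ((S.graph σ).closedWedges x y z : ℝ) := by
    refine le_trans ?_ (sum_le_sum fun σ _ => le_closedWedges σ x y z)
    rw [sum_sub_distrib]
    refine sub_le_sub (le_of_eq ?_) ?_
    · simp only [← sum_ite_eq_card]
      rw [sum_comm, ← nsmul_eq_mul, ← sum_const]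
      refine sum_congr rfl fun t ht => ?_
      rw [sum_ite_eq_card, filter_mem_eq_inter, univ_inter, card_containing ht τ]
    · simp only [sum_filter]
      rw [sum_comm, ← nsmul_eq_mul, ← sum_const]
      refine sum_le_sum fun t ht => ?_
      rw [← sum_filter, filter_mem_eq_inter, univ_inter]
      simp only [← sum_ite_eq_card]
      rw [sum_comm]
      calc _ ≤ ∑ c ∈ reclosings t z, ((S.m - 4).factorial : ℝ) := by
            refine sum_le_sum fun c hc => ?_
            rw [sum_ite_eq_card]
            simp only [reclosings, mem_filter, mem_product, mem_star] at hc
            exact_mod_cast card_containing_mate_le ht hc.2 hc.1.1.2 hc.1.2.2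
        _ ≤ _ := by
            rw [sum_const, nsmul_eq_mul]
            refine mul_le_mul_of_nonneg_right ?_ (Nat.cast_nonneg _)
            exact_mod_cast card_reclosings_le hΔ t z
  have hfac : ((S.m - 3).factorial : ℝ) = (S.m - 3) * (S.m - 4).factorial := by
    obtain ⟨k, hk⟩ : ∃ k, S.m = k + 4 := ⟨S.m - 4, by omega⟩
    have e3 : S.m - 3 = k + 1 := by omega
    have e4 : S.m - 4 = k := by omega
    rw [e3, e4, Nat.factorial_succ, hk]
    push_cast
    ring
  have hre : (Δ : ℝ) ^ 2 * (S.m - 4).factorial ≤ δ * Δ * (S.m - 3).factorial := by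
    rw [hfac]
    have h3 : (Δ : ℝ) ≤ δ * (S.m - 3) :=
      hδ.trans (mul_le_mul_of_nonneg_left (by linarith) hδ0)
    calc (Δ : ℝ) ^ 2 * (S.m - 4).factorial = Δ * Δ * (S.m - 4).factorial := by ring
      _ ≤ Δ * (δ * (S.m - 3)) * (S.m - 4).factorial := by gcongr
      _ = _ := by ring
  have hcard := le_card_triangles x y z h1 h2
  rw [expectation_eq, mul_div_assoc']
  refine div_le_div_of_nonneg_right ?_ (by positivity)
  refine le_trans ?_ (sum_le_sum fun σ _ => hpt σ)
  rw [← sum_div, le_div_iff₀ hW']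
  refine le_trans ?_ hsum
  calc _ = ((1 - 3 * ε) * ((S.pairs x.opp y).card * (S.pairs x z).card *
          (S.pairs y.opp z.opp).card)) * ((1 - δ * Δ) * (S.m - 3).factorial) := by ring
    _ ≤ T.card * ((1 - δ * Δ) * (S.m - 3).factorial) := by
        refine mul_le_mul_of_nonneg_right hcard ?_
        exact mul_nonneg (by linarith) (Nat.cast_nonneg _)
    _ ≤ T.card * ((S.m - 3).factorial - Δ ^ 2 * (S.m - 4).factorial) := by
        refine mul_le_mul_of_nonneg_left ?_ (Nat.cast_nonneg _)
        linarith
    _ = _ := by ring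

end bounds

/-! ### Passage to the limit. -/

lemma factorial_div_bounds {m : ℕ} {ε : ℝ} (hm : 16 ≤ m) (hε : 1 ≤ ε * m) :
    1 / (m : ℝ) ^ 3 ≤ (m - 3).factorial / m.factorial ∧
      ((m - 3).factorial : ℝ) / m.factorial ≤ (1 + 6 * ε) / (m : ℝ) ^ 3 := by
  obtain ⟨k, rfl⟩ : ∃ k, m = k + 3 := ⟨m - 3, by omega⟩
  have hk : (13 : ℝ) ≤ k := by exact_mod_cast (show 13 ≤ k by omega)
  have hf : (0 : ℝ) < k.factorial := by exact_mod_cast k.factorial_pos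
  have e : (((k + 3 - 3).factorial : ℕ) : ℝ) / ((k + 3).factorial : ℕ) =
      1 / ((k + 3) * (k + 2) * (k + 1)) := by
    rw [Nat.add_sub_cancel, Nat.factorial_succ, Nat.factorial_succ, Nat.factorial_succ]
    push_cast
    field_simp
    ring
  rw [e]
  push_cast at hε ⊢
  constructor
  · refine one_div_le_one_div_of_le (by positivity) ?_
    nlinarith
  · rw [div_le_div_iff₀ (by positivity) (by positivity)]
    have h1 : (1 : ℝ) * ((k + 3) * (k + 3)) ≤ ε * (k + 3) * ((k + 2) * (k + 1) * 2) := by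
      refine mul_le_mul hε ?_ (by positivity) (by linarith)
      nlinarith
    nlinarith

/-- Finite form of the asymptotic statements. -/
theorem expectation_bounds {ε : ℝ} (hε : 0 < ε) (hε1 : ε ≤ 1 / 16) (x y z : Dir)
    (hsparse : ∀ (a : Dir) (u : V), (S.deg a u : ℝ) ^ 2 ≤ ε * S.m)
    (hhead : ∀ u, S.stubPairs x z u ≤ ε * ∑ v, S.stubPairs x z v)
    (htail : ∀ u, S.stubPairs y.opp z.opp u ≤ ε * ∑ v, S.stubPairs y.opp z.opp v)
    (hcenter : ∃ v, 0 < S.stubPairs x.opp y v) :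
    1 - 6 * ε ≤ S.expectation (fun G => if 0 < G.wedges x y then 1 else 0) ∧
    |S.expectation (fun G => G.globalClosure x y z) -
        (∑ v, S.stubPairs y.opp z.opp v) * (∑ v, S.stubPairs x z v) / (S.m : ℝ) ^ 3| ≤
      4000 * ε *
        ((∑ v, S.stubPairs y.opp z.opp v) * (∑ v, S.stubPairs x z v) / (S.m : ℝ) ^ 3) := by
  obtain ⟨v, hv⟩ := hcenter
  have hW : 0 < (S.pairs x.opp y).card := by
    rw [← card_pairsAt, Nat.cast_pos, card_pos] at hv
    obtain ⟨p, hp⟩ := hv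
    exact card_pos.2 ⟨p, (mem_pairsAt.1 hp).1⟩
  have hdv : 1 ≤ S.deg x.opp v := by
    rw [Nat.one_le_iff_ne_zero]
    intro h
    simp [stubPairs, h] at hv
  obtain ⟨p, -, hp⟩ := exists_mem_eq_sup (univ : Finset (Dir × V)) ⟨(x, v), mem_univ _⟩
    fun p => S.deg p.1 p.2
  set Δ := (univ : Finset (Dir × V)).sup fun p => S.deg p.1 p.2 with hΔdef
  have hΔ : ∀ a u, S.deg a u ≤ Δ := fun a u =>
    le_sup (f := fun p : Dir × V => S.deg p.1 p.2) (mem_univ (a, u))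
  have hΔ1 : 1 ≤ Δ := hdv.trans (hΔ _ _)
  have hΔ1' : (1 : ℝ) ≤ Δ := by exact_mod_cast hΔ1
  have hΔm : (Δ : ℝ) ^ 2 ≤ ε * S.m := by
    rw [hp]
    exact hsparse _ _
  -- The center has positive degree, so sparsity forces `m` to be large; errors of order `1 / m` are
  -- absorbed in `ε`.
  have hεm : 1 ≤ ε * S.m := by nlinarith
  have hm : (16 : ℝ) ≤ S.m := by
    have : ε * (S.m : ℝ) ≤ 1 / 16 * S.m := by gcongr
    linarith
  have hm' : 16 ≤ S.m := by exact_mod_cast hm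
  have hm0 : (0 : ℝ) < S.m - 8 := by linarith
  -- The value `Δ / (m - 8)` is the least admissible `δ`; since `m ≥ 16` it is at most `2 * Δ / m`.
  have hδ0 : 0 ≤ (Δ : ℝ) / (S.m - 8) := by positivity
  have hδ : (Δ : ℝ) ≤ Δ / (S.m - 8) * (S.m - 8) := by rw [div_mul_cancel₀ _ hm0.ne']
  have hδ2 : (Δ : ℝ) / (S.m - 8) * S.m ≤ 2 * Δ := by
    rw [div_mul_eq_mul_div, div_le_iff₀ hm0]
    nlinarith
  have hδΔ : (Δ : ℝ) / (S.m - 8) * Δ ≤ 2 * ε := by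
    rw [div_mul_eq_mul_div, div_le_iff₀ hm0]
    nlinarith
  set δ : ℝ := (Δ : ℝ) / (S.m - 8) with hδdef
  have hδ1 : δ * Δ ≤ 1 := by linarith
  have hδΔ0 : 0 ≤ δ * Δ := by positivity
  constructor
  · refine le_trans ?_ (one_sub_le_expectation_wedges hΔ hδ0 hδ x y hW)
    have : δ ≤ δ * Δ := le_mul_of_one_le_right hδ0 hΔ1'
    linarith
  · rw [← card_pairs, ← card_pairs] at *
    have hup := expectation_globalClosure_le hΔ hΔ1 hδ0 hδ hδ2 hδ1 x y z hW
    have hlo := le_expectation_globalClosure hΔ hδ0 hδ hδ1 (by omega) x y z hW hhead htail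
    obtain ⟨hf1, hf2⟩ := factorial_div_bounds hm' hεm
    set A : ℝ := ((S.pairs x z).card : ℝ)
    set B : ℝ := ((S.pairs y.opp z.opp).card : ℝ)
    have hA : 0 ≤ A := Nat.cast_nonneg _
    have hB : 0 ≤ B := Nat.cast_nonneg _
    have hR : 0 ≤ B * A / (S.m : ℝ) ^ 3 := by positivity
    rw [abs_sub_le_iff]
    constructor
    · have : A * B * (1 + 1000 * (δ * Δ)) * ((S.m - 3).factorial / S.m.factorial) ≤
          A * B * (1 + 1000 * (2 * ε)) * ((1 + 6 * ε) / (S.m : ℝ) ^ 3) := by gcongr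
      have e : A * B * (1 + 1000 * (2 * ε)) * ((1 + 6 * ε) / (S.m : ℝ) ^ 3) =
          (1 + 1000 * (2 * ε)) * (1 + 6 * ε) * (B * A / (S.m : ℝ) ^ 3) := by ring
      have h2 : (1 + 1000 * (2 * ε)) * (1 + 6 * ε) * (B * A / (S.m : ℝ) ^ 3) ≤
          (1 + 4000 * ε) * (B * A / (S.m : ℝ) ^ 3) := by
        refine mul_le_mul_of_nonneg_right ?_ hR
        nlinarith
      linarith
    · have h3 : (1 - 3 * ε) * (1 - 2 * ε) ≤ (1 - 3 * ε) * (1 - δ * Δ) :=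
        mul_le_mul_of_nonneg_left (by linarith) (by linarith)
      have h4 : (1 - 4000 * ε) ≤ (1 - 3 * ε) * (1 - δ * Δ) := by nlinarith
      have h5 : 0 ≤ (1 - 3 * ε) * (1 - δ * Δ) := mul_nonneg (by linarith) (by linarith)
      have h6 : (1 - 4000 * ε) * (B * A / (S.m : ℝ) ^ 3) ≤
          (1 - 3 * ε) * (1 - δ * Δ) * (A * B) * ((S.m - 3).factorial / S.m.factorial) := by
        calc _ ≤ (1 - 3 * ε) * (1 - δ * Δ) * (B * A / (S.m : ℝ) ^ 3) :=
              mul_le_mul_of_nonneg_right h4 hR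
          _ = (1 - 3 * ε) * (1 - δ * Δ) * (A * B) * (1 / (S.m : ℝ) ^ 3) := by ring
          _ ≤ _ := by gcongr
      linarith

end JointDegSeq

theorem theorem5 (x y z : Dir)
    (V : ℕ → Type*) [∀ k, Fintype (V k)] [∀ k, DecidableEq (V k)]
    (S : ∀ k, JointDegSeq (V k))
    -- sparsity: the maximum degree is `o(√m)`
    (hsparse : ∀ ε : ℝ, 0 < ε → ∀ᶠ k in atTop, ∀ (a : Dir) (u : V k),
      ((S k).deg a u : ℝ) ^ 2 ≤ ε * ((S k).m : ℝ))
    -- no single node dominates either of the two moment sums in the formula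
    (hhead : ∀ ε : ℝ, 0 < ε → ∀ᶠ k in atTop, ∀ u : V k,
      (S k).stubPairs x z u ≤ ε * ∑ v, (S k).stubPairs x z v)
    (htail : ∀ ε : ℝ, 0 < ε → ∀ᶠ k in atTop, ∀ u : V k,
      (S k).stubPairs y.opp z.opp u ≤ ε * ∑ v, (S k).stubPairs y.opp z.opp v)
    -- some node can be the center of a wedge of type `xy`
    (hcenter : ∀ k, ∃ v : V k, 0 < (S k).stubPairs x.opp y v) :
    Tendsto (fun k => (S k).expectation fun G => if 0 < G.wedges x y then 1 else 0)
      atTop (𝓝 1) ∧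
    ∃ r : ℕ → ℝ, Tendsto r atTop (𝓝 0) ∧ ∀ k,
      (S k).expectation (fun G => G.globalClosure x y z) =
        ((S k).M y.opp z.opp -
            (if y = z then 1 else 0) * (((S k).m : ℝ) / (Fintype.card (V k) : ℝ))) *
          ((S k).M x z -
            (if x = z then 1 else 0) * (((S k).m : ℝ) / (Fintype.card (V k) : ℝ))) *
          ((Fintype.card (V k) : ℝ) ^ 2 / ((S k).m : ℝ) ^ 3) * (1 + r k) := by
  have hev : ∀ ε : ℝ, 0 < ε → ε ≤ 1 / 16 → ∀ᶠ k in atTop,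
      1 - 6 * ε ≤ (S k).expectation (fun G => if 0 < G.wedges x y then 1 else 0) ∧
      |(S k).expectation (fun G => G.globalClosure x y z) -
        (∑ v, (S k).stubPairs y.opp z.opp v) * (∑ v, (S k).stubPairs x z v) /
          ((S k).m : ℝ) ^ 3| ≤ 4000 * ε *
        ((∑ v, (S k).stubPairs y.opp z.opp v) * (∑ v, (S k).stubPairs x z v) /
          ((S k).m : ℝ) ^ 3) := by
    intro ε hε hε1
    filter_upwards [hsparse ε hε, hhead ε hε, htail ε hε] with k h1 h2 h3
    exact JointDegSeq.expectation_bounds hε hε1 x y z h1 h2 h3 (hcenter k)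
  have hpos : ∀ (k : ℕ) (a b : Dir), 0 ≤ ∑ v, (S k).stubPairs a b v := fun k a b => by
    rw [← JointDegSeq.card_pairs]; exact Nat.cast_nonneg _
  refine ⟨?_, ?_⟩
  · rw [Metric.tendsto_nhds]
    intro η hη
    filter_upwards [hev (min (η / 12) (1 / 16)) (by positivity) (min_le_right _ _)] with k hk
    have h1 := (S k).expectation_wedges_le_one x y
    have h2 := min_le_left (η / 12) (1 / 16)
    rw [Real.dist_eq, abs_sub_lt_iff]
    constructor <;> linarith [hk.1]
  · set R : ℕ → ℝ := fun k => (∑ v, (S k).stubPairs y.opp z.opp v) *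
      (∑ v, (S k).stubPairs x z v) / ((S k).m : ℝ) ^ 3 with hR
    -- The relative error, which is 0 by division by zero when `R k = 0`; the expectation vanishes
    -- in that case too.
    refine ⟨fun k => ((S k).expectation (fun G => G.globalClosure x y z) - R k) / R k, ?_, ?_⟩
    · rw [Metric.tendsto_nhds]
      intro η hη
      filter_upwards [hev (min (η / 8000) (1 / 16)) (by positivity) (min_le_right _ _)] with k hk
      have h2 := min_le_left (η / 8000) (1 / 16)
      have hR0 : 0 ≤ R k := by
        have := hpos k y.opp z.opp
        have := hpos k x z
        positivity
      rw [Real.dist_eq, sub_zero, abs_div, abs_of_nonneg hR0]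
      have : |(S k).expectation (fun G => G.globalClosure x y z) - R k| / R k ≤
          4000 * min (η / 8000) (1 / 16) := div_le_of_le_mul₀ hR0 (by positivity) hk.2
      linarith
    · intro k
      obtain ⟨v, hv⟩ := hcenter k
      have : Nonempty (V k) := ⟨v⟩
      have hn : (Fintype.card (V k) : ℝ) ≠ 0 := by exact_mod_cast Fintype.card_ne_zero
      have hm : ((S k).m : ℝ) ≠ 0 := by
        intro h
        have h1 : (S k).deg x.opp v ≤ (S k).m := by
          rw [← JointDegSeq.sum_deg x.opp]
          exact Finset.single_le_sum (f := (S k).deg x.opp) (fun _ _ => Nat.zero_le _)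
            (Finset.mem_univ v)
        have h2 : (S k).m = 0 := by exact_mod_cast h
        have h3 : (S k).deg x.opp v = 0 := by omega
        simp [JointDegSeq.stubPairs, h3] at hv
      have e1 := JointDegSeq.moment_formula (S k) y.opp z.opp
      simp only [Dir.opp_inj] at e1
      rw [e1, JointDegSeq.moment_formula (S k) x z]
      have e2 : (∑ v, (S k).stubPairs y.opp z.opp v) / (Fintype.card (V k) : ℝ) *
          ((∑ v, (S k).stubPairs x z v) / (Fintype.card (V k) : ℝ)) *
          ((Fintype.card (V k) : ℝ) ^ 2 / ((S k).m : ℝ) ^ 3) = R k := by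
        rw [hR]
        field_simp
      rw [e2]
      by_cases h0 : R k = 0
      · rw [h0, zero_mul]
        apply JointDegSeq.expectation_globalClosure_eq_zero
        rw [hR] at h0
        simp only [← JointDegSeq.card_pairs, div_eq_zero_iff, mul_eq_zero, Nat.cast_eq_zero] at h0
        rcases h0 with (h0 | h0) | h0
        · exact Or.inr h0
        · exact Or.inl h0
        · exact absurd h0 (pow_ne_zero 3 hm)
      · field_simp
        ring
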